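/- **Proposition.** A *limit group* is a finitely generated group $G$ such that for every finite subset $S\subset G$ there is a homomorphism from $G$ to a free group that is injective on $S$. Let $(\mathcal G,X)$ be a graph of groups over a connected graph $X$ (with injective maps from edge groups to vertex groups) whose fundamental group $\Gamma=\pi_1(\mathcal G,X)$ is a limit group. Let $e$ be an edge of $X$ whose edge group is trivial, let $Y$ be a connected component of $X\smallsetminus\{e\}$ (the graph with all vertices of $X$ and all edges other than $e$), and let $A=\pi_1(\mathcal G,Y)$ be the fundamental group of the restriction of $\mathcal G$ to $Y$. For $R\in\Gamma$, let the $e$-length $\ell_e(R)$ be defined as follows: if $R$ acts on the Bass–Serre tree of $(\mathcal G,X)$ without fixed vertex, then $\ell_e(R)$ is the number of edges lying over $e$ in the quotient $\langle R\rangle\backslash L$ of the axis $L$ of $R$; otherwise $\ell_e(R)=0$. If $R\in\Gamma$ satisfies $\ell_e(R)>0$, then the natural homomorphism $A\to\Gamma/N(R)$ is injective, where $N(R)$ is the normal closure of $R$ in $\Gamma$ (the homomorphism $A\to\Gamma$ is the one induced by the inclusion of $Y$ in $X$ together with any choice of a path in $(\mathcal G,X)$ joining the base vertices). -/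

import Mathlib

universe u u₁ u₂ u₃ u₄

/-- A limit group: a finitely generated group such that every finite subset is mapped injectively
by some homomorphism to a free group. (As the group is finitely generated, only free groups of
finite rank matter, so the universe of the free basis plays no role.) -/
def IsLimitGroup (Γ : Type u) [Group Γ] : Prop :=
  Group.FG Γ ∧ ∀ S : Finset Γ, ∃ (ι : Type u) (φ : Γ →* FreeGroup ι), Set.InjOn φ (S : Set Γ)

/-- A graph, loops and multiple edges allowed, with vertex set `V` and set of (geometric) edges `E`.
Each edge comes with a chosen orientation; the oriented edges of the graph in the sense of Serre are
the elements of `E × Bool`, where `(e, true)` is `e` and `(e, false)` is its inverse. -/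
structure OrGraph (V : Type u₁) (E : Type u₂) where
  src : E → V
  tgt : E → V

namespace OrGraph

variable {V : Type u₁} {E : Type u₂}

/-- The initial vertex of an oriented edge. -/
def ini (X : OrGraph V E) (d : E × Bool) : V := if d.2 then X.src d.1 else X.tgt d.1

/-- The terminal vertex of an oriented edge. -/
def ter (X : OrGraph V E) (d : E × Bool) : V := if d.2 then X.tgt d.1 else X.src d.1

/-- A subgraph: sets of vertices and edges, containing the end points of its edges. -/
structure Subgraph (X : OrGraph V E) where
  verts : Set V
  edges : Set E
  src_mem : ∀ f ∈ edges, X.src f ∈ verts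
  tgt_mem : ∀ f ∈ edges, X.tgt f ∈ verts

/-- The whole graph as a subgraph. -/
def whole (X : OrGraph V E) : X.Subgraph where
  verts := Set.univ
  edges := Set.univ
  src_mem _ _ := trivial
  tgt_mem _ _ := trivial

/-- `X ∖ {e}`: all vertices, and all edges other than `e`. -/
def deleteEdge (X : OrGraph V E) (e : E) : X.Subgraph where
  verts := Set.univ
  edges := {f | f ≠ e}
  src_mem _ _ := trivial
  tgt_mem _ _ := trivial

namespace Subgraph

variable {X : OrGraph V E}

/-- Two vertices are joined by a path that runs through edges of `Z` (in either direction). -/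
def Joined (Z : X.Subgraph) : V → V → Prop :=
  Relation.EqvGen fun v w => ∃ f ∈ Z.edges, X.src f = v ∧ X.tgt f = w

/-- `Y` is a connected component of `Z`. -/
def IsComponentOf (Y Z : X.Subgraph) : Prop :=
  ∃ v ∈ Z.verts, Y.verts = {w | w ∈ Z.verts ∧ Z.Joined v w} ∧
    Y.edges = {f | f ∈ Z.edges ∧ X.src f ∈ Y.verts}

/-- A subgraph as a graph in its own right. -/
abbrev toGraph (Y : X.Subgraph) : OrGraph Y.verts Y.edges where
  src f := ⟨X.src f.1, Y.src_mem f.1 f.2⟩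
  tgt f := ⟨X.tgt f.1, Y.tgt_mem f.1 f.2⟩

end Subgraph

/-- Any two vertices are joined by an edge path, and there is at least one vertex. -/
def Connected (X : OrGraph V E) : Prop :=
  Nonempty V ∧ ∀ v w : V, X.whole.Joined v w

end OrGraph

/-- A graph of groups over the graph `X`: vertex groups, edge groups, and for each edge an
injective homomorphism from its group into the group of each of its two ends. -/
structure GraphOfGroups {V : Type u₁} {E : Type u₂} (X : OrGraph V E) where
  vGrp : V → Type u₃
  eGrp : E → Type u₄
  [vGroup : ∀ v, Group (vGrp v)]
  [eGroup : ∀ e, Group (eGrp e)]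
  toSrc : ∀ e, eGrp e →* vGrp (X.src e)
  toTgt : ∀ e, eGrp e →* vGrp (X.tgt e)
  toSrc_injective : ∀ e, Function.Injective (toSrc e)
  toTgt_injective : ∀ e, Function.Injective (toTgt e)

attribute [instance] GraphOfGroups.vGroup GraphOfGroups.eGroup

namespace GraphOfGroups

variable {V : Type u₁} {E : Type u₂} {X : OrGraph V E}

/-- The restriction of a graph of groups to a subgraph. -/
abbrev restrict (G : GraphOfGroups.{u₁, u₂, u₃, u₄} X) (Y : X.Subgraph) :
    GraphOfGroups.{u₁, u₂, u₃, u₄} Y.toGraph where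
  vGrp v := G.vGrp v.1
  eGrp f := G.eGrp f.1
  toSrc f := G.toSrc f.1
  toTgt f := G.toTgt f.1
  toSrc_injective f := G.toSrc_injective f.1
  toTgt_injective f := G.toTgt_injective f.1

/-- The free product of all vertex groups and of the free group on the edges. -/
abbrev FreePathGroup (G : GraphOfGroups.{u₁, u₂, u₃, u₄} X) : Type (max u₁ u₂ u₃) :=
  Monoid.Coprod (Monoid.CoprodI G.vGrp) (FreeGroup E)

/-- The relators `e · (g at the end of e) · e⁻¹ · (g at the origin of e)⁻¹`. -/
def relators (G : GraphOfGroups.{u₁, u₂, u₃, u₄} X) : Set G.FreePathGroup :=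
  {x | ∃ (e : E) (g : G.eGrp e), x =
    Monoid.Coprod.inr (FreeGroup.of e) *
      Monoid.Coprod.inl (Monoid.CoprodI.of (G.toTgt e g)) *
      (Monoid.Coprod.inr (FreeGroup.of e))⁻¹ *
      (Monoid.Coprod.inl (Monoid.CoprodI.of (G.toSrc e g)))⁻¹}

/-- Serre's group `F(𝒢, X)`: the free product of the vertex groups and of the free group on the
edges, modulo `e · (g at the end of e) · e⁻¹ = (g at the origin of e)` for `g` in the group
of `e`. -/
abbrev PathGroup (G : GraphOfGroups.{u₁, u₂, u₃, u₄} X) : Type (max u₁ u₂ u₃) :=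
  G.FreePathGroup ⧸ Subgroup.normalClosure G.relators

/-- The canonical map of a vertex group to `F(𝒢, X)`. -/
def ofVert (G : GraphOfGroups.{u₁, u₂, u₃, u₄} X) (v : V) : G.vGrp v →* G.PathGroup :=
  (QuotientGroup.mk' (Subgroup.normalClosure G.relators)).comp
    (Monoid.Coprod.inl.comp Monoid.CoprodI.of)

/-- The element of `F(𝒢, X)` given by an edge (in its chosen orientation). -/
def ofEdge (G : GraphOfGroups.{u₁, u₂, u₃, u₄} X) (e : E) : G.PathGroup :=
  QuotientGroup.mk' (Subgroup.normalClosure G.relators) (Monoid.Coprod.inr (FreeGroup.of e))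

theorem ofEdge_mul_toTgt (G : GraphOfGroups.{u₁, u₂, u₃, u₄} X) (e : E) (g : G.eGrp e) :
    G.ofEdge e * G.ofVert _ (G.toTgt e g) * (G.ofEdge e)⁻¹ = G.ofVert _ (G.toSrc e g) := by
  rw [← mul_inv_eq_one]
  have h : (Monoid.Coprod.inr (FreeGroup.of e) *
      Monoid.Coprod.inl (Monoid.CoprodI.of (G.toTgt e g)) *
      (Monoid.Coprod.inr (FreeGroup.of e))⁻¹ *
      (Monoid.Coprod.inl (Monoid.CoprodI.of (G.toSrc e g)))⁻¹ : G.FreePathGroup) ∈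
      Subgroup.normalClosure G.relators :=
    Subgroup.subset_normalClosure ⟨e, g, rfl⟩
  exact (QuotientGroup.eq_one_iff _).2 h

/-- `G.IsPath v w x`: the element `x` of `F(𝒢, X)` is represented by a path from `v` to `w`, i.e.
by a word `g₀ d₁ g₁ d₂ ⋯ dₙ gₙ` where `d₁ ⋯ dₙ` is an edge path from `v` to `w` and each `gᵢ` lies
in the group of the `i`-th vertex of that path. -/
inductive IsPath (G : GraphOfGroups.{u₁, u₂, u₃, u₄} X) : V → V → G.PathGroup → Prop
  | vert (v : V) (g : G.vGrp v) : IsPath G v v (G.ofVert v g)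
  | edge (e : E) : IsPath G (X.src e) (X.tgt e) (G.ofEdge e)
  | edgeInv (e : E) : IsPath G (X.tgt e) (X.src e) (G.ofEdge e)⁻¹
  | mul {v w z : V} {x y : G.PathGroup} :
      IsPath G v w x → IsPath G w z y → IsPath G v z (x * y)

theorem IsPath.inv {G : GraphOfGroups.{u₁, u₂, u₃, u₄} X} {v w : V} {x : G.PathGroup}
    (h : G.IsPath v w x) : G.IsPath w v x⁻¹ := by
  induction h with
  | vert v g => rw [← map_inv]; exact .vert v g⁻¹
  | edge e => exact .edgeInv e
  | edgeInv e => rw [inv_inv]; exact .edge e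
  | mul _ _ h₁ h₂ => rw [mul_inv_rev]; exact .mul h₂ h₁

/-- The fundamental group `π₁(𝒢, X, x₀)`: the elements of `F(𝒢, X)` represented by closed paths
at `x₀`. -/
def piOne (G : GraphOfGroups.{u₁, u₂, u₃, u₄} X) (x₀ : V) : Subgroup G.PathGroup where
  carrier := {x | G.IsPath x₀ x₀ x}
  mul_mem' h₁ h₂ := IsPath.mul h₁ h₂
  one_mem' := by
    have h := IsPath.vert (G := G) x₀ 1
    rwa [map_one] at h
  inv_mem' h := IsPath.inv h

section NaturalMap

/-- The natural map from the free product of the groups of `Y` and of the free group on the edges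
of `Y` to `F(𝒢, X)`, for a subgraph `Y` of `X`. -/
def freePathGroupMap (G : GraphOfGroups.{u₁, u₂, u₃, u₄} X) (Y : X.Subgraph) :
    (G.restrict Y).FreePathGroup →* G.PathGroup :=
  Monoid.Coprod.lift
    (Monoid.CoprodI.lift (M := (G.restrict Y).vGrp) fun v => G.ofVert v.1)
    (FreeGroup.lift fun f : Y.edges => G.ofEdge f.1)

theorem freePathGroupMap_vert (G : GraphOfGroups.{u₁, u₂, u₃, u₄} X) (Y : X.Subgraph)
    (v : Y.verts) (g : (G.restrict Y).vGrp v) :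
    G.freePathGroupMap Y (Monoid.Coprod.inl (Monoid.CoprodI.of g)) = G.ofVert v.1 g := by
  rw [freePathGroupMap, Monoid.Coprod.lift_apply_inl, Monoid.CoprodI.lift_of]

theorem freePathGroupMap_edge (G : GraphOfGroups.{u₁, u₂, u₃, u₄} X) (Y : X.Subgraph)
    (f : Y.edges) :
    G.freePathGroupMap Y (Monoid.Coprod.inr (FreeGroup.of f)) = G.ofEdge f.1 := by
  rw [freePathGroupMap, Monoid.Coprod.lift_apply_inr, FreeGroup.lift_apply_of]

/-- The natural map `F(𝒢|Y, Y) → F(𝒢, X)` for a subgraph `Y` of `X`. -/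
def pathGroupMap (G : GraphOfGroups.{u₁, u₂, u₃, u₄} X) (Y : X.Subgraph) :
    (G.restrict Y).PathGroup →* G.PathGroup :=
  QuotientGroup.lift (Subgroup.normalClosure (G.restrict Y).relators) (G.freePathGroupMap Y) (by
    intro x hx
    refine (Subgroup.normalClosure_le_normal (N := (G.freePathGroupMap Y).ker) ?_) hx
    rintro _ ⟨f, g, rfl⟩
    rw [SetLike.mem_coe, MonoidHom.mem_ker, map_mul, map_mul, map_mul, map_inv, map_inv,
      freePathGroupMap_vert, freePathGroupMap_vert, freePathGroupMap_edge, mul_inv_eq_one]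
    exact G.ofEdge_mul_toTgt f.1 g)

theorem pathGroupMap_ofVert (G : GraphOfGroups.{u₁, u₂, u₃, u₄} X) (Y : X.Subgraph)
    (v : Y.verts) (g : (G.restrict Y).vGrp v) :
    G.pathGroupMap Y ((G.restrict Y).ofVert v g) = G.ofVert v.1 g :=
  G.freePathGroupMap_vert Y v g

theorem pathGroupMap_ofEdge (G : GraphOfGroups.{u₁, u₂, u₃, u₄} X) (Y : X.Subgraph)
    (f : Y.edges) :
    G.pathGroupMap Y ((G.restrict Y).ofEdge f) = G.ofEdge f.1 :=
  G.freePathGroupMap_edge Y f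

theorem IsPath.map {G : GraphOfGroups.{u₁, u₂, u₃, u₄} X} {Y : X.Subgraph} {v w : Y.verts}
    {x : (G.restrict Y).PathGroup} (h : (G.restrict Y).IsPath v w x) :
    G.IsPath v.1 w.1 (G.pathGroupMap Y x) := by
  induction h with
  | vert v g => exact G.pathGroupMap_ofVert Y v g ▸ IsPath.vert v.1 g
  | edge e => rw [pathGroupMap_ofEdge]; exact .edge e.1
  | edgeInv e => rw [map_inv, pathGroupMap_ofEdge]; exact .edgeInv e.1
  | mul _ _ h₁ h₂ => rw [map_mul]; exact .mul h₁ h₂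

/-- The natural map `π₁(𝒢|Y, Y, y₀) → π₁(𝒢, X, x₀)` determined by a path `c` from `x₀` to `y₀`,
namely `a ↦ c a c⁻¹`. (For `x₀ = y₀` and `c = 1` this is the map induced by the inclusion of `Y`;
another `c` changes it by an inner automorphism of `π₁(𝒢, X, x₀)`.) -/
def piOneMap (G : GraphOfGroups.{u₁, u₂, u₃, u₄} X) (Y : X.Subgraph) (y₀ : Y.verts) (x₀ : V)
    (c : G.PathGroup) (hc : G.IsPath x₀ y₀.1 c) :
    (G.restrict Y).piOne y₀ →* G.piOne x₀ where
  toFun a := ⟨c * G.pathGroupMap Y a.1 * c⁻¹, (hc.mul (IsPath.map a.2)).mul hc.inv⟩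
  map_one' := by ext; simp
  map_mul' a b := by ext; simp

end NaturalMap

section BassSerreTree

/-- The image of a vertex group in `F(𝒢, X)`. -/
def vertSubgroup (G : GraphOfGroups.{u₁, u₂, u₃, u₄} X) (v : V) : Subgroup G.PathGroup :=
  (G.ofVert v).range

/-- The image of an edge group in `F(𝒢, X)`, through the group of the origin of the edge. -/
def edgeSubgroup (G : GraphOfGroups.{u₁, u₂, u₃, u₄} X) (e : E) : Subgroup G.PathGroup :=
  ((G.ofVert (X.src e)).comp (G.toSrc e)).range

theorem edgeSubgroup_le (G : GraphOfGroups.{u₁, u₂, u₃, u₄} X) (e : E) :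
    G.edgeSubgroup e ≤ G.vertSubgroup (X.src e) := by
  rintro _ ⟨g, rfl⟩
  exact ⟨G.toSrc e g, rfl⟩

/-- Vertices of the Bass–Serre tree based at `x₀`: over the vertex `v` of `X` lie the cosets
`p · 𝒢_v`, where `p` is (the class of) a path from `x₀` to `v`. -/
def TreeVert (G : GraphOfGroups.{u₁, u₂, u₃, u₄} X) (x₀ : V) : Type (max u₁ u₂ u₃) :=
  Σ v : V, {q : G.PathGroup ⧸ G.vertSubgroup v // ∃ p, G.IsPath x₀ v p ∧ QuotientGroup.mk p = q}

/-- Edges of the Bass–Serre tree based at `x₀`: over the edge `e` of `X` lie the cosets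
`p · 𝒢_e`, where `p` is (the class of) a path from `x₀` to the origin of `e`. -/
def TreeEdge (G : GraphOfGroups.{u₁, u₂, u₃, u₄} X) (x₀ : V) : Type (max u₁ u₂ u₃) :=
  Σ e : E, {q : G.PathGroup ⧸ G.edgeSubgroup e //
    ∃ p, G.IsPath x₀ (X.src e) p ∧ QuotientGroup.mk p = q}

/-- The map `p · 𝒢_e ↦ p e · 𝒢_{t(e)}`. -/
def cosetTgt (G : GraphOfGroups.{u₁, u₂, u₃, u₄} X) (e : E) :
    G.PathGroup ⧸ G.edgeSubgroup e → G.PathGroup ⧸ G.vertSubgroup (X.tgt e) :=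
  Quotient.map' (fun p => p * G.ofEdge e) (by
    intro p q h
    rw [QuotientGroup.leftRel_apply] at h ⊢
    obtain ⟨g, hg⟩ := h
    refine ⟨G.toTgt e g, ?_⟩
    have h₁ := G.ofEdge_mul_toTgt e g
    have h₂ : G.ofVert _ (G.toSrc e g) = p⁻¹ * q := hg
    rw [h₂] at h₁
    rw [mul_inv_rev, mul_assoc, ← mul_assoc p⁻¹, ← h₁]
    group)

/-- The Bass–Serre tree of a graph of groups, based at `x₀`: the edge `p · 𝒢_e` leads from
`p · 𝒢_{o(e)}` to `p e · 𝒢_{t(e)}`. -/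
def tree (G : GraphOfGroups.{u₁, u₂, u₃, u₄} X) (x₀ : V) :
    OrGraph (G.TreeVert x₀) (G.TreeEdge x₀) where
  src ε := ⟨X.src ε.1, Subgroup.quotientMapOfLE (G.edgeSubgroup_le ε.1) ε.2.1, by
    obtain ⟨p, hp, h⟩ := ε.2.2
    exact ⟨p, hp, by rw [← h]; rfl⟩⟩
  tgt ε := ⟨X.tgt ε.1, G.cosetTgt ε.1 ε.2.1, by
    obtain ⟨p, hp, h⟩ := ε.2.2
    exact ⟨p * G.ofEdge ε.1, hp.mul (.edge ε.1), by rw [← h]; rfl⟩⟩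

/-- `π₁(𝒢, X, x₀)` acts on the vertices of the Bass–Serre tree by left multiplication. -/
instance (G : GraphOfGroups.{u₁, u₂, u₃, u₄} X) (x₀ : V) :
    MulAction (G.piOne x₀) (G.TreeVert x₀) where
  smul γ ν := ⟨ν.1, γ.1 • ν.2.1, by
    obtain ⟨p, hp, h⟩ := ν.2.2
    exact ⟨γ.1 * p, IsPath.mul γ.2 hp, by rw [← h]; rfl⟩⟩
  one_smul ν := Sigma.ext rfl (heq_of_eq (Subtype.ext (one_smul G.PathGroup ν.2.1)))
  mul_smul γ δ ν := Sigma.ext rfl (heq_of_eq (Subtype.ext (mul_smul γ.1 δ.1 ν.2.1)))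

/-- `π₁(𝒢, X, x₀)` acts on the edges of the Bass–Serre tree by left multiplication. -/
instance (G : GraphOfGroups.{u₁, u₂, u₃, u₄} X) (x₀ : V) :
    MulAction (G.piOne x₀) (G.TreeEdge x₀) where
  smul γ ε := ⟨ε.1, γ.1 • ε.2.1, by
    obtain ⟨p, hp, h⟩ := ε.2.2
    exact ⟨γ.1 * p, IsPath.mul γ.2 hp, by rw [← h]; rfl⟩⟩
  one_smul ε := Sigma.ext rfl (heq_of_eq (Subtype.ext (one_smul G.PathGroup ε.2.1)))
  mul_smul γ δ ε := Sigma.ext rfl (heq_of_eq (Subtype.ext (mul_smul γ.1 δ.1 ε.2.1)))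

/-- The bi-infinite sequence `α` of oriented edges is an axis of `R` in the Bass–Serre tree with
translation length `k`: an edge path through pairwise distinct vertices (in a tree: a bi-infinite
geodesic) that `R` maps to itself, as a translation by `k > 0` edges. Such an axis exists exactly
when `R` is hyperbolic, i.e. fixes no vertex, and it is then unique up to its parametrization. -/
structure IsAxis (G : GraphOfGroups.{u₁, u₂, u₃, u₄} X) (x₀ : V) (R : G.piOne x₀)
    (α : ℤ → G.TreeEdge x₀ × Bool) (k : ℕ) : Prop where
  pos : 0 < k
  chain : ∀ n, (G.tree x₀).ter (α n) = (G.tree x₀).ini (α (n + 1))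
  distinct : Function.Injective fun n => (G.tree x₀).ini (α n)
  shift : ∀ n, α (n + k) = (R • (α n).1, (α n).2)

open Classical in
/-- The `e`-length `ℓ_e(R)`, for an edge `e` of `X`: the number of edges of the quotient
of the axis of `R` by the translation `R` that lie over `e` (the edges of the tree over `e` form one
orbit of the fundamental group). It is `0` if `R` has no axis, i.e. is not hyperbolic. -/
noncomputable def eLength (G : GraphOfGroups.{u₁, u₂, u₃, u₄} X) (x₀ : V) (e : E)
    (R : G.piOne x₀) : ℕ :=
  if h : ∃ a : (ℤ → G.TreeEdge x₀ × Bool) × ℕ, G.IsAxis x₀ R a.1 a.2 then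
    ((Finset.range h.choose.2).filter fun i => (h.choose.1 (i : ℤ)).1.1 = e).card
  else 0

end BassSerreTree

end GraphOfGroups

universe w

/-!
Collapse the graph of groups to a free group: a homomorphism of `Γ` to a free group `F`, injective
on a suitable finite set, extends to `F(𝒢, X)`, and since the group of `e` is trivial, `e` itself
may be sent to a new free generator `t`. The axis of `R` exhibits a conjugate of `R` as a cyclic
product of syllables `t^{±1} u`, where `u` is a loop in `X ∖ {e}`, not homotopic to a constant one,
whenever `t` changes its sign, because the axis does not backtrack. So the image of `R` is
represented by a cyclically reduced word in which `t` occurs, and by Magnus' Freiheitssatz `F`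
embeds into the quotient of `F * ⟨t⟩` by this image. An element of `A` whose image in `F` is not
trivial therefore survives in `Γ / N(R)`.

For the Freiheitssatz itself, let `σ` be the exponent sum of `t` in the relator. If `σ ≠ 0`, the
relator, regarded as an equation for `t` over `F`, is solvable over each finite `p`-group quotient
of `F` with `p` prime to `σ`, and `F` is residually a finite `p`-group. If `σ = 0`, the relator is
rewritten in the conjugates of the other generators by the powers of `t`, where it becomes shorter,
and the one-relator group is mapped to an HNN extension of the group with the rewritten relator, `t`
going to the stable letter.
-/

namespace Freiheitssatz

open FreeGroup (of lift mk)

section Nilpotent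

variable {S P : Type*} [DecidableEq S] [Group P]

/-- The exponent sum of the generator `t`. -/
def expSum (t : S) : FreeGroup S →* Multiplicative ℤ :=
  lift (Pi.mulSingle t (.ofAdd 1))

theorem lift_update_mul_of_mem_center (f : S → P) (t : S) {z : P} (hz : z ∈ Subgroup.center P)
    (w : FreeGroup S) :
    lift (Function.update f t (f t * z)) w = lift f w * z ^ (expSum t w).toAdd := by
  let zHom : Multiplicative ℤ →* Subgroup.center P := zpowersHom _ ⟨z, hz⟩
  let ψ : FreeGroup S →* P :=
    { toFun w := lift f w * zHom (expSum t w)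
      map_one' := by simp
      map_mul' x y := by
        have hc := Subgroup.mem_center_iff.1 (zHom (expSum t x)).2 (lift f y)
        rw [map_mul, map_mul, map_mul, Subgroup.coe_mul, mul_assoc, mul_assoc,
          ← mul_assoc _ _ (zHom _ : P), hc,
          mul_assoc] }
  have h : lift (Function.update f t (f t * z)) = ψ := by
    ext s
    obtain rfl | hs := eq_or_ne s t <;> simp [ψ, zHom, expSum, *]
  simpa [ψ, zHom] using DFunLike.congr_fun h w

theorem bijective_zpow_center {n : ℤ} (h : Function.Bijective fun x : P => x ^ n) :
    Function.Bijective fun x : Subgroup.center P => x ^ n := by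
  refine ⟨fun x y hxy => Subtype.ext (h.1 (congrArg Subtype.val hxy)), fun x => ?_⟩
  obtain ⟨y, hy : y ^ n = x⟩ := h.2 x
  refine ⟨⟨y, Subgroup.mem_center_iff.2 fun g => ?_⟩, Subtype.ext hy⟩
  have hconj : (g * y * g⁻¹) ^ n = y ^ n := by
    rw [conj_zpow, hy, Subgroup.mem_center_iff.1 x.2 g, mul_inv_cancel_right]
  exact mul_inv_eq_iff_eq_mul.1 (h.1 hconj)

theorem bijective_zpow_quotient_center {n : ℤ} (h : Function.Bijective fun x : P => x ^ n) :
    Function.Bijective fun x : P ⧸ Subgroup.center P => x ^ n := by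
  constructor
  · intro x y
    obtain ⟨a, rfl⟩ := QuotientGroup.mk_surjective x
    obtain ⟨b, rfl⟩ := QuotientGroup.mk_surjective y
    intro (hab : ((a ^ n : P) : P ⧸ Subgroup.center P) = (b ^ n : P))
    obtain ⟨z, hz⟩ := (bijective_zpow_center h).2 ⟨_, QuotientGroup.eq.1 hab⟩
    have hz' : (z : P) ^ n = (a ^ n)⁻¹ * b ^ n := congrArg Subtype.val hz
    have hb : (a * z) ^ n = b ^ n := by
      rw [(show Commute a z from Subgroup.mem_center_iff.1 z.2 a).mul_zpow, hz',
        mul_inv_cancel_left]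
    exact QuotientGroup.eq.2 (by rw [← h.1 hb, inv_mul_cancel_left]; exact z.2)
  · intro x
    obtain ⟨a, rfl⟩ := QuotientGroup.mk_surjective x
    obtain ⟨b, rfl⟩ := h.2 a
    exact ⟨b, rfl⟩

theorem exists_lift_update_eq_one (t : S) (w : FreeGroup S) [Group.IsNilpotent P]
    (h : Function.Bijective fun x : P => x ^ (expSum t w).toAdd) (f : S → P) :
    ∃ y : P, lift (Function.update f t y) w = 1 := by
  revert h f
  refine Group.nilpotent_center_quotient_ind
    (P := fun P _ _ => (Function.Bijective fun x : P => x ^ (expSum t w).toAdd) →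
      ∀ f : S → P, ∃ y : P, lift (Function.update f t y) w = 1) P
    (fun _ _ _ _ _ => ⟨1, Subsingleton.elim _ _⟩) fun P _ _ ih h f => ?_
  obtain ⟨y', hy'⟩ := ih (bijective_zpow_quotient_center h) fun s => (f s : P ⧸ Subgroup.center P)
  obtain ⟨y, rfl⟩ := QuotientGroup.mk_surjective y'
  have hcomp : (QuotientGroup.mk' (Subgroup.center P)).comp (lift (Function.update f t y)) =
      lift (Function.update (fun s => (f s : P ⧸ Subgroup.center P)) t y) := by
    ext s
    obtain rfl | hs := eq_or_ne s t <;> simp [*]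
  have hcenter : lift (Function.update f t y) w ∈ Subgroup.center P :=
    (QuotientGroup.eq_one_iff _).1 ((DFunLike.congr_fun hcomp w).trans hy')
  obtain ⟨z, hz⟩ := (bijective_zpow_center h).2 ⟨_, inv_mem hcenter⟩
  refine ⟨y * z, ?_⟩
  have hlift := lift_update_mul_of_mem_center (Function.update f t y) t z.2 w
  rw [Function.update_self, Function.update_idem] at hlift
  rw [hlift, show (z : P) ^ (expSum t w).toAdd = _ from congrArg Subtype.val hz, mul_inv_cancel]

end Nilpotent

section Unitriangular

variable {n R : Type*} [Fintype n] [LinearOrder n] [CommRing R]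

variable (n R) in
/-- The monoid of upper triangular matrices with ones on the diagonal. -/
def unitriangular : Submonoid (Matrix n n R) where
  carrier := {M | M.IsUpperTriangular ∧ ∀ i, M i i = 1}
  one_mem' := ⟨Matrix.blockTriangular_one, Matrix.one_apply_eq⟩
  mul_mem' := by
    rintro A B ⟨hA, hA'⟩ ⟨hB, hB'⟩
    refine ⟨hA.mul hB, fun i => ?_⟩
    rw [Matrix.mul_apply, Finset.sum_eq_single_of_mem i (Finset.mem_univ i), hA', hB', one_mul]
    intro k _ hk
    obtain hk | hk := hk.lt_or_gt
    · rw [hA hk, zero_mul]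
    · rw [hB hk, mul_zero]

theorem sub_one_pow_card_eq_zero {M : Matrix n n R} (hM : M ∈ unitriangular n R) :
    (M - 1) ^ Fintype.card n = 0 := by
  have hcharpoly : M.charpoly = (Polynomial.X - 1) ^ Fintype.card n := by
    simp [M.charpoly_of_isUpperTriangular hM.1, hM.2]
  simpa [hcharpoly] using M.aeval_self_charpoly

theorem isPGroup_units_unitriangular (p : ℕ) [Fact p.Prime] [CharP R p] :
    IsPGroup p (unitriangular n R)ˣ := by
  intro u
  let N : Matrix n n R := u.1.1 - 1
  have hN : N ^ p ^ Fintype.card n = 0 :=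
    pow_eq_zero_of_le (Nat.lt_pow_self (Fact.out : p.Prime).one_lt).le
      (sub_one_pow_card_eq_zero u.1.2)
  refine ⟨Fintype.card n, Units.ext (Subtype.ext ?_)⟩
  cases isEmpty_or_nonempty n
  · exact Subsingleton.elim _ _
  calc u.1.1 ^ p ^ Fintype.card n = (1 + N) ^ p ^ Fintype.card n := by rw [add_sub_cancel]
    _ = 1 := by rw [add_pow_char_pow_of_commute p _ (Commute.one_left N), one_pow, hN, add_zero]

/-- The one-parameter group `m ↦ 1 + m N` of unitriangular matrices given by a strictly upper
triangular matrix `N` of square zero. -/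
def shear (N : Matrix n n R) (hN : N * N = 0) (hN' : ∀ i j, j ≤ i → N i j = 0) :
    Multiplicative ℤ →* unitriangular n R where
  toFun m := ⟨1 + m.toAdd • N,
    Matrix.blockTriangular_one.add fun i j hij => by simp [-zsmul_eq_mul, hN' i j hij.le],
    fun i => by simp [-zsmul_eq_mul, hN' i i le_rfl]⟩
  map_one' := by simp
  map_mul' a b := Subtype.ext <| by
    simp [-zsmul_eq_mul, add_mul, mul_add, hN, add_smul, add_assoc]

end Unitriangular

section Superdiagonal

variable {R : Type*} [Semiring R] {n : ℕ}

theorem list_prod_apply_eq_zero (l : List (Matrix (Fin n) (Fin n) R))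
    (hl : ∀ A ∈ l, ∀ i j : Fin n, (i : ℕ) + 1 < j → A i j = 0) (i j : Fin n)
    (hij : (i : ℕ) + l.length < j) : l.prod i j = 0 := by
  induction l generalizing i with
  | nil => exact Matrix.one_apply_ne (by rintro rfl; simp at hij)
  | cons A l ih =>
    rw [List.prod_cons, Matrix.mul_apply]
    refine Finset.sum_eq_zero fun k _ => ?_
    rw [List.length_cons] at hij
    obtain hk | hk := lt_or_ge ((i : ℕ) + 1) k
    · rw [hl A (by simp) i k hk, zero_mul]
    · rw [ih (fun B hB => hl B (by simp [hB])) k (by omega), mul_zero]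

theorem list_prod_apply_ne_zero [Nontrivial R] [NoZeroDivisors R]
    (l : List (Matrix (Fin n) (Fin n) R))
    (hl : ∀ A ∈ l, ∀ i j : Fin n, (i : ℕ) + 1 < j → A i j = 0) (i j : Fin n)
    (hij : (i : ℕ) + l.length = j)
    (hne : ∀ (m : ℕ) (hm : m < l.length) (a b : Fin n), (a : ℕ) = i + m → (b : ℕ) = a + 1 →
      l[m] a b ≠ 0) : l.prod i j ≠ 0 := by
  induction l generalizing i with
  | nil => obtain rfl : i = j := Fin.ext (by simpa using hij); simp
  | cons A l ih =>
    rw [List.length_cons] at hij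
    have hl' : ∀ B ∈ l, ∀ i j : Fin n, (i : ℕ) + 1 < j → B i j = 0 :=
      fun B hB => hl B (by simp [hB])
    let i' : Fin n := ⟨i + 1, by omega⟩
    have hprod : (A :: l).prod i j = A i i' * l.prod i' j := by
      rw [List.prod_cons, Matrix.mul_apply, Finset.sum_eq_single_of_mem i' (Finset.mem_univ i')]
      intro k _ hk
      obtain hk | hk := lt_or_gt_of_ne (Fin.val_ne_of_ne hk)
      · rw [list_prod_apply_eq_zero l hl' k j (by simp only [i'] at hk; omega), mul_zero]
      · rw [hl A (by simp) i k hk, zero_mul]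
    rw [hprod]
    refine mul_ne_zero (hne 0 (by simp) i i' rfl rfl) (ih hl' i' (by simp only [i']; omega) ?_)
    intro m hm a b ha
    exact hne (m + 1) (by simpa using hm) a b (by simp only [i'] at ha; omega)

end Superdiagonal

section ResiduallyP

variable {S : Type*}

theorem exists_syllables (w : FreeGroup S) :
    ∃ l : List (S × ℤ), l.IsChain (fun a b => a.1 ≠ b.1) ∧ (∀ a ∈ l, a.2 ≠ 0) ∧
      (l.map fun a => of a.1 ^ a.2).prod = w := by
  classical
  let W := Monoid.CoprodI.Word.equiv (freeGroupEquivCoprodI w)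
  have hW : W.prod = freeGroupEquivCoprodI w := Monoid.CoprodI.Word.equiv.symm_apply_apply _
  let n : FreeGroup Unit → ℤ := FreeGroup.freeGroupUnitEquivInt
  have hn : ∀ x, of () ^ n x = x := FreeGroup.freeGroupUnitEquivInt.symm_apply_apply
  refine ⟨W.toList.map fun a => (a.1, n a.2), ?_, ?_, ?_⟩
  · exact (List.isChain_map _).2 W.chain_ne
  · simp only [List.mem_map]
    rintro _ ⟨a, ha, rfl⟩ (h0 : n a.2 = 0)
    exact W.ne_one a ha (by rw [← hn a.2, h0, zpow_zero])
  · apply freeGroupEquivCoprodI.injective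
    rw [← hW, Monoid.CoprodI.Word.prod, map_list_prod, List.map_map, List.map_map]
    refine congrArg List.prod (List.map_congr_left fun a _ => ?_)
    have := congrArg (Monoid.CoprodI.of (M := fun _ : S => FreeGroup Unit) (i := a.1)) (hn a.2)
    simpa using this

/-- The matrix whose superdiagonal is the indicator function of the positions at which `s` occurs
in `l`. -/
def positionMatrix [DecidableEq S] (R : Type*) [Zero R] [One R] (l : List S) (s : S) :
    Matrix (Fin (l.length + 1)) (Fin (l.length + 1)) R :=
  .of fun i j => if (j : ℕ) = i + 1 ∧ l[(i : ℕ)]? = some s then 1 else 0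

variable [DecidableEq S] (R : Type*) [CommRing R]

theorem positionMatrix_apply_of_ne (l : List S) (s : S) {i j : Fin (l.length + 1)}
    (hij : (j : ℕ) ≠ i + 1) : positionMatrix R l s i j = 0 := by
  simp [positionMatrix, hij]

theorem positionMatrix_mul_self {l : List S} (hl : l.IsChain (· ≠ ·)) (s : S) :
    positionMatrix R l s * positionMatrix R l s = 0 := by
  ext i j
  rw [Matrix.mul_apply]
  refine Finset.sum_eq_zero fun m _ => ?_
  by_contra hne
  have h₁ : (m : ℕ) = i + 1 ∧ l[(i : ℕ)]? = some s := by
    by_contra h; exact hne (by simp [positionMatrix, h])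
  have h₂ : (j : ℕ) = m + 1 ∧ l[(m : ℕ)]? = some s := by
    by_contra h; exact hne (by simp [positionMatrix, h])
  rw [h₁.1, List.getElem?_eq_some_iff] at h₂
  obtain ⟨-, hm, hms⟩ := h₂
  obtain ⟨hi, his⟩ := List.getElem?_eq_some_iff.1 h₁.2
  exact List.isChain_iff_getElem.1 hl i hm (his.trans hms.symm)

/-- The representation of the free group sending each generator `s` to
`1 + positionMatrix R l s`. -/
def positionRep {l : List S} (hl : l.IsChain (· ≠ ·)) :
    FreeGroup S →* (unitriangular (Fin (l.length + 1)) R)ˣ :=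
  lift fun s => (shear (positionMatrix R l s) (positionMatrix_mul_self R hl s) fun i j hij =>
    positionMatrix_apply_of_ne R l s (by have : (j : ℕ) ≤ i := hij; omega)).toHomUnits (.ofAdd 1)

theorem positionRep_of_zpow {l : List S} (hl : l.IsChain (· ≠ ·)) (s : S) (m : ℤ) :
    (positionRep R hl (of s ^ m)).1.1 = 1 + m • positionMatrix R l s := by
  rw [positionRep, map_zpow, FreeGroup.lift_apply_of, ← map_zpow, ← ofAdd_zsmul, smul_eq_mul,
    mul_one]
  rfl

theorem positionRep_ne_one [IsDomain R] (l : List (S × ℤ))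
    (hl : (l.map Prod.fst).IsChain (· ≠ ·)) (hne : ∀ a ∈ l, (a.2 : R) ≠ 0) (hnil : l ≠ []) :
    positionRep R hl (l.map fun a => of a.1 ^ a.2).prod ≠ 1 := by
  intro h1
  let N := positionMatrix R (l.map Prod.fst)
  have hprod : (l.map fun a => 1 + a.2 • N a.1).prod = 1 := by
    have := congrArg (fun u : (unitriangular _ R)ˣ => u.1.1) h1
    rw [map_list_prod, ← Units.coeHom_apply, map_list_prod, Submonoid.coe_list_prod] at this
    simpa only [List.map_map, Function.comp_def, Units.coeHom_apply, positionRep_of_zpow,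
      Units.val_one, Submonoid.coe_one] using this
  have hlength : 0 < l.length := List.length_pos_iff.2 hnil
  refine list_prod_apply_ne_zero (l.map fun a => 1 + a.2 • N a.1) ?_ 0 (Fin.last _) (by simp) ?_ ?_
  · simp only [List.mem_map]
    rintro _ ⟨a, -, rfl⟩ i j hij
    have : i ≠ j := by rintro rfl; omega
    simp [N, -zsmul_eq_mul, positionMatrix_apply_of_ne R _ _ hij.ne', this]
  · intro m hm i j hi hj
    rw [List.length_map] at hm
    have : i ≠ j := by rintro rfl; omega
    have hmi : m = i := by simpa using hi.symm
    subst hmi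
    rw [List.getElem_map]
    simpa [N, -zsmul_eq_mul, positionMatrix, this, hj, hm] using hne _ (List.getElem_mem hm)
  · rw [hprod]
    exact Matrix.one_apply_ne (Fin.ne_of_val_ne (by simpa using hlength.ne))

end ResiduallyP

section NonzeroExponentSum

variable {S : Type*}

theorem exists_isPGroup_hom_ne_one {w : FreeGroup S} (hw : w ≠ 1) :
    ∃ B : ℕ, ∀ (p : ℕ) [Fact p.Prime], B < p →
      ∃ (P : Type) (_ : Group P) (_ : Finite P) (f : FreeGroup S →* P), IsPGroup p P ∧ f w ≠ 1 := by
  classical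
  obtain ⟨l, hl, hl0, rfl⟩ := exists_syllables w
  refine ⟨(l.map fun a => a.2.natAbs).sum, fun p _ hp => ?_⟩
  have hchain : (l.map Prod.fst).IsChain (· ≠ ·) := (List.isChain_map _).2 hl
  refine ⟨_, inferInstance, inferInstance, positionRep (ZMod p) hchain,
    isPGroup_units_unitriangular p, positionRep_ne_one _ l hchain (fun a ha h0 => ?_) ?_⟩
  · have hle : a.2.natAbs ≤ (l.map fun a => a.2.natAbs).sum :=
      List.le_sum_of_mem (List.mem_map_of_mem ha)
    have hdvd : p ∣ a.2.natAbs :=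
      Int.natCast_dvd.1 ((ZMod.intCast_zmod_eq_zero_iff_dvd a.2 p).1 h0)
    exact absurd (Nat.le_of_dvd (Int.natAbs_pos.2 (hl0 a ha)) hdvd) (by omega)
  · rintro rfl
    exact hw (by simp)

theorem bijective_zpow_of_isPGroup {p : ℕ} [Fact p.Prime] {P : Type*} [Group P] (hP : IsPGroup p P)
    {n : ℤ} (hn : ¬ (p : ℤ) ∣ n) : Function.Bijective fun x : P => x ^ n := by
  obtain ⟨m, hm⟩ := n.eq_nat_or_neg
  have hpm : ¬ p ∣ m := fun h => hn <| by
    rcases hm with rfl | rfl <;> simpa using Int.natCast_dvd_natCast.2 h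
  have hpow : Function.Bijective fun x : P => x ^ m := (hP.powEquiv' hpm).bijective
  rcases hm with rfl | rfl
  · simpa using hpow
  · simpa [Function.comp_def] using (Equiv.inv P).bijective.comp hpow

variable [DecidableEq S]

theorem eq_one_of_mem_normalClosure_of_expSum_ne_zero {t : S} {r : FreeGroup S}
    (hr : (expSum t r).toAdd ≠ 0) {a : FreeGroup {s // s ≠ t}}
    (ha : FreeGroup.map Subtype.val a ∈ Subgroup.normalClosure {r}) : a = 1 := by
  by_contra hne
  obtain ⟨B, hB⟩ := exists_isPGroup_hom_ne_one
    ((map_ne_one_iff _ (FreeGroup.map_injective Subtype.val_injective)).2 hne)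
  obtain ⟨p, hp, hprime⟩ := Nat.exists_infinite_primes (B + (expSum t r).toAdd.natAbs + 1)
  have : Fact p.Prime := ⟨hprime⟩
  obtain ⟨P, _, _, f, hP, hfa⟩ := hB p (by omega)
  have := hP.isNilpotent
  have hdvd : ¬ (p : ℤ) ∣ (expSum t r).toAdd := fun h => by
    have := Nat.le_of_dvd (Int.natAbs_pos.2 hr) (Int.natCast_dvd.1 h)
    omega
  obtain ⟨y, hy⟩ := exists_lift_update_eq_one t r (bijective_zpow_of_isPGroup hP hdvd) (f ∘ of)
  let g : FreeGroup S →* P := lift (Function.update (f ∘ of) t y)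
  have hker : Subgroup.normalClosure {r} ≤ g.ker :=
    Subgroup.normalClosure_le_normal (Set.singleton_subset_iff.2 hy)
  have hgf : g.comp (FreeGroup.map (Subtype.val : {s // s ≠ t} → S)) =
      f.comp (FreeGroup.map Subtype.val) := by
    ext s
    simp [g, s.2]
  exact hfa ((DFunLike.congr_fun hgf a).symm.trans (hker ha))

end NonzeroExponentSum

section Letters

variable {S : Type*}

theorem isReduced_cons_append_singleton {c : S} {ε δ : Bool} {L : List (S × Bool)}
    (hL : FreeGroup.IsReduced L) (hc : ∀ a ∈ L, a.1 ≠ c) (hεδ : ε ≠ δ → L ≠ []) :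
    FreeGroup.IsReduced ((c, ε) :: L ++ [(c, δ)]) := by
  rcases eq_or_ne L [] with rfl | hne
  · simpa [FreeGroup.IsReduced] using hεδ
  · refine List.isChain_append.2 ⟨List.isChain_cons.2 ⟨fun a ha hac => ?_, hL⟩, by simp,
      fun a ha b hb hab => ?_⟩
    · exact absurd hac.symm (hc a (List.mem_of_mem_head? ha))
    · obtain rfl : (c, δ) = b := by simpa using hb
      rw [List.getLast?_cons_of_ne_nil hne] at ha
      exact absurd hab (hc a (List.mem_of_mem_getLast? ha))

variable [DecidableEq S]

/-- The generators that occur in the reduced word of `x`. -/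
def letters (x : FreeGroup S) : Finset S :=
  (x.toWord.map Prod.fst).toFinset

theorem mem_letters {x : FreeGroup S} {t : S} : t ∈ letters x ↔ ∃ b, (t, b) ∈ x.toWord := by
  simp [letters]

theorem hom_eq_of_eqOn_letters {H : Type*} [Group H] {f g : FreeGroup S →* H} {x : FreeGroup S}
    (h : ∀ s ∈ letters x, f (of s) = g (of s)) : f x = g x := by
  have hprod (φ : FreeGroup S →* H) :
      φ x = (x.toWord.map fun a => bif a.2 then φ (of a.1) else (φ (of a.1))⁻¹).prod := by
    have h := FreeGroup.lift_mk (f := fun s => φ (of s)) (L := x.toWord)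
    rw [FreeGroup.mk_toWord] at h
    exact (DFunLike.congr_fun (lift.apply_symm_apply φ) x).symm.trans h
  rw [hprod, hprod]
  refine congrArg List.prod (List.map_congr_left fun a ha => ?_)
  rw [h a.1 (mem_letters.2 ⟨a.2, ha⟩)]

/-- The number of occurrences of `t` and its inverse in the reduced word of `x`. -/
def letterCount (t : S) (x : FreeGroup S) : ℕ :=
  x.toWord.countP fun a => a.1 = t

theorem letterCount_pos {x : FreeGroup S} {t : S} : 0 < letterCount t x ↔ t ∈ letters x := by
  simp [letterCount, letters, List.countP_pos_iff]

theorem letterCount_mul_le (t : S) (x y : FreeGroup S) :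
    letterCount t (x * y) ≤ letterCount t x + letterCount t y := by
  rw [letterCount, letterCount, letterCount, ← List.countP_append]
  exact (FreeGroup.toWord_mul_sublist x y).countP_le

theorem letterCount_map_eq_zero {T : Type*} {f : T → S} {t : S} (hf : t ∉ Set.range f)
    (x : FreeGroup T) : letterCount t (FreeGroup.map f x) = 0 := by
  classical
  rw [← FreeGroup.mk_toWord (x := x), FreeGroup.map.mk, letterCount, FreeGroup.toWord_mk]
  refine Nat.eq_zero_of_le_zero (FreeGroup.reduce.red.sublist.countP_le.trans_eq ?_)
  rw [List.countP_map, List.countP_eq_zero]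
  exact fun a _ ha => hf ⟨a.1, by simpa using ha⟩

theorem le_letterCount_pow {x : FreeGroup S} (hx : FreeGroup.IsCyclicallyReduced x.toWord) {t : S}
    (ht : t ∈ letters x) (n : ℕ) : n ≤ letterCount t (x ^ n) := by
  have hpow : (x ^ n).toWord = (List.replicate n x.toWord).flatten := by
    rw [← FreeGroup.mk_toWord (x := x), FreeGroup.pow_mk, FreeGroup.toWord_mk, FreeGroup.mk_toWord,
      (hx.flatten_replicate n).isReduced.reduce_eq]
  rw [letterCount, hpow, List.countP_flatten, List.map_replicate, List.sum_replicate, smul_eq_mul]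
  exact Nat.le_mul_of_pos_right n (letterCount_pos.2 ht)

theorem ne_conj_map_of_isCyclicallyReduced {x : FreeGroup S}
    (hx : FreeGroup.IsCyclicallyReduced x.toWord) {t : S} (ht : t ∈ letters x) {T : Type*}
    {f : T → S} (hf : t ∉ Set.range f) (g : FreeGroup S) (y : FreeGroup T) :
    x ≠ g * FreeGroup.map f y * g⁻¹ := by
  intro hxy
  -- Compare the number of occurrences of `t` in a high power of both sides.
  let n := letterCount t g + letterCount t g⁻¹ + 1
  have hpow : x ^ n = g * FreeGroup.map f (y ^ n) * g⁻¹ := by rw [hxy, conj_pow, ← map_pow]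
  have h₁ := le_letterCount_pow hx ht n
  have h₂ := letterCount_mul_le t (g * FreeGroup.map f (y ^ n)) g⁻¹
  have h₃ := letterCount_mul_le t g (FreeGroup.map f (y ^ n))
  rw [letterCount_map_eq_zero hf] at h₃
  rw [hpow] at h₁
  omega

theorem exists_conj_isCyclicallyReduced (x : FreeGroup S) :
    ∃ g y : FreeGroup S, FreeGroup.IsCyclicallyReduced y.toWord ∧ y.norm ≤ x.norm ∧
      x = g * y * g⁻¹ := by
  let L := FreeGroup.reduceCyclically x.toWord
  let C := FreeGroup.reduceCyclically.conjugator x.toWord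
  have hL : FreeGroup.IsCyclicallyReduced L :=
    FreeGroup.reduceCyclically.isCyclicallyReduced FreeGroup.isReduced_toWord
  have hLx : C ++ L ++ FreeGroup.invRev C = x.toWord :=
    FreeGroup.reduceCyclically.conj_conjugator_reduceCyclically x.toWord
  refine ⟨mk C, mk L, ?_, FreeGroup.norm_mk_le.trans ?_, ?_⟩
  · rwa [FreeGroup.toWord_mk, hL.isReduced.reduce_eq]
  · rw [FreeGroup.norm, ← hLx]
    simp only [List.length_append]
    omega
  · rw [FreeGroup.inv_mk, FreeGroup.mul_mk, FreeGroup.mul_mk, hLx, FreeGroup.mk_toWord]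

end Letters

section Rewriting

variable {S : Type*}

/-- The action of `ℤ` on the free group on `T × ℤ` by translation of the second coordinate. -/
def shift (T : Type*) : Multiplicative ℤ →* MulAut (FreeGroup (T × ℤ)) where
  toFun n := FreeGroup.freeGroupCongr ((Equiv.refl T).prodCongr (Equiv.addRight n.toAdd))
  map_one' := by
    ext x : 1
    simp [FreeGroup.freeGroupCongr_apply]
  map_mul' m n := by
    refine MulEquiv.toMonoidHom_injective (FreeGroup.ext_hom _ _ fun a => ?_)
    simp [Prod.map, add_assoc, add_comm m.toAdd]

theorem shift_of {T : Type*} (n : ℤ) (a : T × ℤ) :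
    shift T (.ofAdd n) (of a) = of (a.1, a.2 + n) := rfl

theorem norm_shift_le {T : Type*} [DecidableEq T] (n : Multiplicative ℤ)
    (x : FreeGroup (T × ℤ)) : (shift T n x).norm ≤ x.norm := by
  conv_lhs => rw [← FreeGroup.mk_toWord (x := x)]
  exact FreeGroup.norm_mk_le.trans_eq (by simp [FreeGroup.norm])

/-- The homomorphism that sends the letter `(s, j)` to `t ^ j * s * t ^ (-j)`. -/
def conjHom (t : S) : FreeGroup ({s // s ≠ t} × ℤ) →* FreeGroup S :=
  lift fun a => of t ^ a.2 * of a.1.1 * (of t ^ a.2)⁻¹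

theorem conjHom_shift (t : S) (n : Multiplicative ℤ) :
    (conjHom t).comp (shift {s // s ≠ t} n).toMonoidHom =
      (MulAut.conj (zpowersHom _ (of t) n)).toMonoidHom.comp (conjHom t) := by
  ext ⟨s, j⟩
  obtain ⟨n, rfl⟩ := Multiplicative.ofAdd.surjective n
  simp [-map_zpow, conjHom, shift_of, zpowersHom_apply, zpow_add, mul_assoc,
    ((Commute.refl (of t)).zpow_zpow j n).eq]

variable [DecidableEq S]

/-- The rewriting homomorphism from the free group on `S` to its decomposition as the semidirect
product of the free group on the letters `t ^ j * s * t ^ (-j)` by the infinite cyclic group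
generated by `t`. -/
def rewriteHom (t : S) :
    FreeGroup S →* FreeGroup ({s // s ≠ t} × ℤ) ⋊[shift {s // s ≠ t}] Multiplicative ℤ :=
  lift fun s => if h : s = t then .inr (.ofAdd 1) else .inl (of (⟨s, h⟩, 0))

theorem right_rewriteHom (t : S) (x : FreeGroup S) : (rewriteHom t x).right = expSum t x := by
  have h : SemidirectProduct.rightHom.comp (rewriteHom t) = expSum t := by
    ext s
    obtain rfl | hs := eq_or_ne s t <;> simp [rewriteHom, expSum, *]
  exact DFunLike.congr_fun h x

theorem conjHom_left_rewriteHom_mul (t : S) (x : FreeGroup S) :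
    conjHom t (rewriteHom t x).left * of t ^ (expSum t x).toAdd = x := by
  have h : (SemidirectProduct.lift (conjHom t) (zpowersHom _ (of t)) (conjHom_shift t)).comp
      (rewriteHom t) = .id _ := by
    ext s
    obtain rfl | hs := eq_or_ne s t <;> simp [rewriteHom, conjHom, *]
  rw [← right_rewriteHom]
  exact DFunLike.congr_fun h x

theorem norm_left_rewriteHom_mul_le (t : S) (x y : FreeGroup S) :
    (rewriteHom t (x * y)).left.norm ≤ (rewriteHom t x).left.norm + (rewriteHom t y).left.norm := by
  rw [map_mul, SemidirectProduct.mul_left]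
  exact (FreeGroup.norm_mul_le _ _).trans (Nat.add_le_add_left (norm_shift_le _ _) _)

theorem norm_left_rewriteHom_letter_le (t : S) (a : S × Bool) :
    (rewriteHom t (mk [a])).left.norm ≤ if a.1 ≠ t then 1 else 0 := by
  obtain ⟨s, b⟩ := a
  obtain rfl | hs := eq_or_ne s t
  · cases b <;> simp [rewriteHom]
  · cases b <;> simp [rewriteHom, hs]

theorem norm_left_rewriteHom_mk_le (t : S) (L : List (S × Bool)) :
    (rewriteHom t (mk L)).left.norm ≤ L.countP fun a => a.1 ≠ t := by
  induction L with
  | nil => simp [← FreeGroup.one_eq_mk]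
  | cons a L ih =>
    rw [List.countP_cons, ← List.singleton_append, ← FreeGroup.mul_mk, add_comm]
    simpa using (norm_left_rewriteHom_mul_le t _ _).trans
      (Nat.add_le_add (norm_left_rewriteHom_letter_le t a) ih)

theorem norm_left_rewriteHom_lt {t : S} {x : FreeGroup S} (ht : t ∈ letters x) :
    (rewriteHom t x).left.norm < x.norm := by
  obtain ⟨b, hb⟩ := mem_letters.1 ht
  conv_lhs => rw [← FreeGroup.mk_toWord (x := x)]
  refine (norm_left_rewriteHom_mk_le t _).trans_lt (List.countP_le_length.lt_of_ne fun h => ?_)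
  simpa using List.countP_eq_length.1 h _ hb

end Rewriting

section StableLetter

theorem exists_conj_eq_of_injective {B : Type u} {D : Type*} [Group B] [Group D] {i₁ i₂ : D →* B}
    (h₁ : Function.Injective i₁) (h₂ : Function.Injective i₂) :
    ∃ (K : Type u) (_ : Group K) (ι : B →* K) (τ : K), Function.Injective ι ∧
      ∀ d, ι (i₂ d) = τ * ι (i₁ d) * τ⁻¹ := by
  let φ : i₁.range ≃* i₂.range := (MonoidHom.ofInjective h₁).symm.trans (MonoidHom.ofInjective h₂)
  refine ⟨HNNExtension B i₁.range i₂.range φ, inferInstance, HNNExtension.of, HNNExtension.t,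
    HNNExtension.of_injective φ, fun d => ?_⟩
  simpa [φ, MonoidHom.ofInjective_apply] using
    HNNExtension.equiv_eq_conj (φ := φ) (MonoidHom.ofInjective h₁ d)

theorem eq_conj_zpow_of_succ {K : Type*} [Group K] {τ : K} {c : ℤ → K} {m M : ℤ}
    (hc : ∀ j, m ≤ j → j < M → c (j + 1) = τ * c j * τ⁻¹) {j : ℤ} (hm : m ≤ j) (hM : j ≤ M) :
    c j = τ ^ j * (τ ^ (-m) * c m * τ ^ m) * (τ ^ j)⁻¹ := by
  induction j, hm using Int.leInduction with
  | base => group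
  | succ j hm ih =>
    rw [hc j hm (by omega), ih (by omega)]
    group

/-- The homomorphism onto the Magnus subgroup generated by the letters other than `t` in the
one-relator group with relator `r`. -/
def magnusHom {S : Type*} (r : FreeGroup S) (t : S) :
    FreeGroup {s // s ≠ t} →* FreeGroup S ⧸ Subgroup.normalClosure {r} :=
  (QuotientGroup.mk' _).comp (FreeGroup.map Subtype.val)

theorem magnusHom_injective_iff {S : Type*} {r : FreeGroup S} {t : S} :
    Function.Injective (magnusHom r t) ↔
      ∀ a : FreeGroup {s // s ≠ t}, FreeGroup.map Subtype.val a ∈ Subgroup.normalClosure {r} →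
        a = 1 := by
  simp only [injective_iff_map_eq_one, magnusHom, MonoidHom.comp_apply, QuotientGroup.mk'_apply,
    QuotientGroup.eq_one_iff]

theorem injective_mk_comp_map {T D : Type*} {r : FreeGroup T} {q : T}
    (hr : Function.Injective (magnusHom r q)) {j : D → T} (hj : Function.Injective j)
    (hq : ∀ d, j d ≠ q) :
    Function.Injective ((QuotientGroup.mk' (Subgroup.normalClosure {r})).comp
      (FreeGroup.map j)) := by
  have hcomp : (QuotientGroup.mk' (Subgroup.normalClosure {r})).comp (FreeGroup.map j) =
      (magnusHom r q).comp (FreeGroup.map fun d => ⟨j d, hq d⟩) := by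
    ext d
    simp [magnusHom]
  rw [hcomp]
  exact hr.comp (FreeGroup.map_injective fun _ _ h => hj (congrArg Subtype.val h))

theorem exists_stableLetter {T : Type u} {y : FreeGroup (T × ℤ)} {m M : ℤ} {p q : T}
    (hp : Function.Injective (magnusHom y (p, m))) (hq : Function.Injective (magnusHom y (q, M))) :
    ∃ (K : Type u) (_ : Group K) (ι : FreeGroup (T × ℤ) ⧸ Subgroup.normalClosure {y} →* K) (τ : K)
      (c : T → K), Function.Injective ι ∧ ∀ s j, m ≤ j → j ≤ M →
        ι (of (s, j) : FreeGroup (T × ℤ)) = τ ^ j * c s * (τ ^ j)⁻¹ := by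
  let D := {d : T × ℤ // m ≤ d.2 ∧ d.2 < M}
  have h₁ := injective_mk_comp_map hq (j := (Subtype.val : D → T × ℤ)) Subtype.val_injective
    fun d hd => d.2.2.ne (congrArg Prod.snd hd)
  have h₂ := injective_mk_comp_map hp (j := fun d : D => (d.1.1, d.1.2 + 1))
    (fun a b h => Subtype.ext (Prod.ext (Prod.ext_iff.1 h).1
      (add_right_cancel (Prod.ext_iff.1 h).2)))
    fun d hd => (Int.lt_add_one_of_le d.2.1).ne' (congrArg Prod.snd hd)
  obtain ⟨K, _, ι, τ, hι, hτ⟩ := exists_conj_eq_of_injective h₁ h₂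
  refine ⟨K, inferInstance, ι, τ, fun s => τ ^ (-m) * ι (of (s, m) : FreeGroup (T × ℤ)) * τ ^ m, hι,
    fun s j hm hM => ?_⟩
  exact eq_conj_zpow_of_succ (c := fun j => ι (of (s, j) : FreeGroup (T × ℤ)))
    (fun j hm hM => by simpa using hτ (of ⟨(s, j), hm, hM⟩)) hm hM

end StableLetter

section Magnus

variable {S : Type u} [DecidableEq S]

theorem magnusHom_conjHom_injective {t : S}
    {y : FreeGroup ({s // s ≠ t} × ℤ)} {m M : ℤ}
    (hmM : m < M) (hy : ∀ a ∈ letters y, m ≤ a.2 ∧ a.2 ≤ M) {p q : {s // s ≠ t}}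
    (hp : Function.Injective (magnusHom y (p, m))) (hq : Function.Injective (magnusHom y (q, M))) :
    Function.Injective (magnusHom (conjHom t y) t) := by
  obtain ⟨K, _, ι, τ, c, hι, hc⟩ := exists_stableLetter hp hq
  let f : FreeGroup S →* K := lift fun s => if h : s = t then τ else c ⟨s, h⟩
  have hrel : f (conjHom t y) = 1 := by
    have hfy : (f.comp (conjHom t)) y = (ι.comp (QuotientGroup.mk' _)) y := by
      refine hom_eq_of_eqOn_letters fun ⟨s, j⟩ hs => ?_
      simp [f, conjHom, s.2, hc s j (hy _ hs).1 (hy _ hs).2]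
    have hy : (y : FreeGroup _ ⧸ Subgroup.normalClosure {y}) = 1 :=
      (QuotientGroup.eq_one_iff y).2 (Subgroup.subset_normalClosure rfl)
    simpa [hy] using hfy
  have hker : Subgroup.normalClosure {conjHom t y} ≤ f.ker :=
    Subgroup.normalClosure_le_normal (Set.singleton_subset_iff.2 hrel)
  have hcomp : (MulAut.conj (τ ^ m)).toMonoidHom.comp
      ((QuotientGroup.lift _ f hker).comp (magnusHom (conjHom t y) t)) =
      ι.comp ((QuotientGroup.mk' _).comp (FreeGroup.map fun s => (s, m))) := by
    ext s
    simp [-map_zpow, magnusHom, f, s.2, hc s m le_rfl hmM.le]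
  have hinj := hι.comp (injective_mk_comp_map hq (j := fun s => (s, m))
    (fun _ _ h => congrArg Prod.fst h) fun _ h => hmM.ne (congrArg Prod.snd h))
  rw [← MonoidHom.coe_comp, ← hcomp] at hinj
  rw [MonoidHom.coe_comp, MonoidHom.coe_comp] at hinj
  exact hinj.of_comp.of_comp

theorem exists_letter_snd_ne {t : S} {r g : FreeGroup S} {y : FreeGroup ({s // s ≠ t} × ℤ)}
    (hr : FreeGroup.IsCyclicallyReduced r.toWord) (ht : t ∈ letters r)
    (hy : r = g * conjHom t y * g⁻¹) (j : ℤ) : ∃ a ∈ letters y, a.2 ≠ j := by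
  by_contra! hj
  refine ne_conj_map_of_isCyclicallyReduced hr ht (f := (Subtype.val : {s // s ≠ t} → S))
    (fun ⟨s, hs⟩ => s.2 hs) (g * of t ^ j) (FreeGroup.map Prod.fst y) ?_
  have hconj : conjHom t y = ((MulAut.conj (of t ^ j)).toMonoidHom.comp
      ((FreeGroup.map Subtype.val).comp (FreeGroup.map Prod.fst))) y := by
    refine hom_eq_of_eqOn_letters fun a ha => ?_
    simp [-map_zpow, conjHom, hj a ha]
  rw [hy, hconj]
  simp [-map_zpow, mul_assoc]

theorem map_mem_normalClosure_singleton {H K : Type*} [Group H] [Group K] (f : H →* K) {x y : H}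
    (h : y ∈ Subgroup.normalClosure {x}) : f y ∈ Subgroup.normalClosure {f x} := by
  rw [← Set.image_singleton]
  exact Subgroup.comap_normalClosure_image_ge _ f h

theorem normalClosure_singleton_conj {H : Type*} [Group H] (g x : H) :
    Subgroup.normalClosure {g * x * g⁻¹} = Subgroup.normalClosure {x} := by
  refine le_antisymm (Subgroup.normalClosure_le_normal (Set.singleton_subset_iff.2 ?_))
    (Subgroup.normalClosure_le_normal (Set.singleton_subset_iff.2 ?_))
  · exact Subgroup.normalClosure_normal.conj_mem _
      (Subgroup.subset_normalClosure (Set.mem_singleton x)) g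
  · have h := Subgroup.normalClosure_normal.conj_mem _
      (Subgroup.subset_normalClosure (Set.mem_singleton (g * x * g⁻¹))) g⁻¹
    rwa [show g⁻¹ * (g * x * g⁻¹) * g⁻¹⁻¹ = x by group] at h

theorem magnusHom_injective {r : FreeGroup S}
    (hr : FreeGroup.IsCyclicallyReduced r.toWord) {t : S} (ht : t ∈ letters r) :
    Function.Injective (magnusHom r t) := by
  induction hn : r.norm using Nat.strong_induction_on generalizing S with | _ n ih
  by_cases hsum : (expSum t r).toAdd = 0
  swap
  · exact magnusHom_injective_iff.2 fun a => eq_one_of_mem_normalClosure_of_expSum_ne_zero hsum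
  obtain ⟨g, y, hy, hle, hgy⟩ := exists_conj_isCyclicallyReduced (rewriteHom t r).left
  have hlt : y.norm < n := hn ▸ hle.trans_lt (norm_left_rewriteHom_lt ht)
  have hconj : r = conjHom t g * conjHom t y * (conjHom t g)⁻¹ := by
    simpa [hsum, hgy] using (conjHom_left_rewriteHom_mul t r).symm
  have hsnd := exists_letter_snd_ne hr ht hconj
  have hne : (letters y).Nonempty := (hsnd 0).imp fun _ h => h.1
  obtain ⟨p, hp, hmin⟩ := (letters y).exists_min_image Prod.snd hne
  obtain ⟨q, hq, hmax⟩ := (letters y).exists_max_image Prod.snd hne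
  obtain ⟨a, ha, hap⟩ := hsnd p.2
  rw [magnusHom_injective_iff, hconj, normalClosure_singleton_conj, ← magnusHom_injective_iff]
  exact magnusHom_conjHom_injective (((hmin a ha).lt_of_ne' hap).trans_le (hmax a ha))
    (fun b hb => ⟨hmin b hb, hmax b hb⟩) (ih _ hlt hy hp rfl) (ih _ hlt hy hq rfl)

end Magnus

end Freiheitssatz

/-- `IsSyllableProduct t B N ε δ x`: the element `x` is a product of syllables `t * u` and
`t⁻¹ * u` with `u ∈ B`, where `u` has to lie in `N` whenever the exponent of `t` changes its sign
after `u`. The exponent of the first syllable is positive if and only if `ε = true`, and a syllable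
with the sign `δ` may follow `x`. -/
inductive IsSyllableProduct {H : Type*} [Group H] (t : H) (B : Subgroup H) (N : Set H) :
    Bool → Bool → H → Prop
  | syllable {ε δ : Bool} {u : H} (hB : u ∈ B) (hN : ε ≠ δ → u ∈ N) :
      IsSyllableProduct t B N ε δ ((bif ε then t else t⁻¹) * u)
  | mul {ε δ η : Bool} {x y : H} (hx : IsSyllableProduct t B N ε δ x)
      (hy : IsSyllableProduct t B N δ η y) : IsSyllableProduct t B N ε η (x * y)

namespace IsSyllableProduct

open FreeGroup (of)

theorem exists_finset {H : Type*} [Group H] {t x : H} {B : Subgroup H} {N : Set H} {ε δ : Bool}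
    (h : IsSyllableProduct t B N ε δ x) :
    ∃ S : Finset H, (∀ u ∈ S, u ∈ B ∧ u ∈ N) ∧
      ∀ {K : Type u} [Group K] (f : H →* K) {B' : Subgroup K} {N' : Set K},
        B ≤ B'.comap f → (∀ u ∈ S, f u ∈ N') → IsSyllableProduct (f t) B' N' ε δ (f x) := by
  classical
  induction h with
  | @syllable ε δ u hB hN =>
    refine ⟨if ε ≠ δ then {u} else ∅, by aesop, fun f B' N' hBB' hN' => ?_⟩
    have hfu : f ((bif ε then t else t⁻¹) * u) = (bif ε then f t else (f t)⁻¹) * f u := by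
      cases ε <;> simp
    rw [hfu]
    exact .syllable (hBB' hB) fun hεδ => hN' u (by simp [hεδ])
  | mul _ _ ihx ihy =>
    obtain ⟨S₁, hS₁, hx⟩ := ihx
    obtain ⟨S₂, hS₂, hy⟩ := ihy
    refine ⟨S₁ ∪ S₂, fun u hu => (Finset.mem_union.1 hu).elim (hS₁ u) (hS₂ u),
      fun f B' N' hBB' hN' => ?_⟩
    rw [map_mul]
    exact .mul (hx f hBB' fun u hu => hN' u (Finset.mem_union_left _ hu))
      (hy f hBB' fun u hu => hN' u (Finset.mem_union_right _ hu))

variable {ι : Type u} {x : FreeGroup (Option ι)} {ε δ : Bool}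

theorem exists_isReduced (h : IsSyllableProduct (of none) (FreeGroup.map some).range {1}ᶜ ε δ x) :
    ∃ L : List (Option ι × Bool),
      FreeGroup.IsReduced ((none, ε) :: L ++ [(none, δ)]) ∧ FreeGroup.mk ((none, ε) :: L) = x := by
  classical
  induction h with
  | @syllable ε δ u hB hN =>
    obtain ⟨v, rfl⟩ := hB
    refine ⟨v.toWord.map fun a => (some a.1, a.2), Freiheitssatz.isReduced_cons_append_singleton
      ((List.isChain_map _).2 (FreeGroup.isReduced_toWord.imp fun _ _ hab h =>
        hab (Option.some_injective _ h)))
      (List.forall_mem_map.2 fun _ _ => Option.some_ne_none _) fun h hv => ?_, ?_⟩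
    · rw [List.map_eq_nil_iff, FreeGroup.toWord_eq_nil_iff] at hv
      exact hN h (by simp [hv])
    · have hv : FreeGroup.mk (v.toWord.map fun a => (some a.1, a.2)) = FreeGroup.map some v := by
        conv_rhs => rw [← FreeGroup.mk_toWord (x := v), FreeGroup.map.mk]
      rw [← List.singleton_append, ← FreeGroup.mul_mk, hv]
      cases ε <;> rfl
  | @mul ε δ η x y _ _ ihx ihy =>
    obtain ⟨L₁, hL₁, rfl⟩ := ihx
    obtain ⟨L₂, hL₂, rfl⟩ := ihy
    refine ⟨L₁ ++ (none, δ) :: L₂, ?_, by rw [FreeGroup.mul_mk, List.cons_append]⟩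
    have h := hL₁.append_overlap (L₃ := L₂ ++ [(none, η)]) hL₂ (List.cons_ne_nil _ _)
    simpa only [List.cons_append, List.append_assoc, List.nil_append] using h

theorem eq_one_of_map_some_mem_normalClosure
    (h : IsSyllableProduct (of none) (FreeGroup.map some).range {1}ᶜ ε ε x) {a : FreeGroup ι}
    (ha : FreeGroup.map some a ∈ Subgroup.normalClosure {x}) : a = 1 := by
  classical
  obtain ⟨L, hL, rfl⟩ := h.exists_isReduced
  have hLc : FreeGroup.IsCyclicallyReduced ((none, ε) :: L) :=
    ⟨(List.isChain_append.1 hL).1, fun b hb c hc => (List.isChain_append.1 hL).2.2 b hb c hc⟩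
  have hword : (FreeGroup.mk ((none, ε) :: L)).toWord = (none, ε) :: L :=
    FreeGroup.toWord_mk.trans hLc.isReduced.reduce_eq
  have hinj := Freiheitssatz.injective_mk_comp_map (Freiheitssatz.magnusHom_injective
    (hword.symm ▸ hLc) (Freiheitssatz.mem_letters.2 ⟨ε, hword.symm ▸ List.mem_cons_self⟩))
    (Option.some_injective ι) Option.some_ne_none
  exact (injective_iff_map_eq_one _).1 hinj a ((QuotientGroup.eq_one_iff _).2 ha)

end IsSyllableProduct

theorem OrGraph.Subgraph.ter_mem {V : Type u₁} {E : Type u₂} {X : OrGraph V E} (Y : X.Subgraph)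
    {d : E × Bool} (hd : d.1 ∈ Y.edges) : X.ter d ∈ Y.verts := by
  obtain ⟨f, _ | _⟩ := d
  · exact Y.src_mem f hd
  · exact Y.tgt_mem f hd

theorem OrGraph.Subgraph.IsComponentOf.edges_subset {V : Type u₁} {E : Type u₂}
    {X : OrGraph V E} {Y Z : X.Subgraph} (hY : Y.IsComponentOf Z) : Y.edges ⊆ Z.edges := by
  obtain ⟨v, -, -, hedges⟩ := hY
  exact hedges ▸ fun _ hf => hf.1

theorem OrGraph.Subgraph.IsComponentOf.src_tgt_notMem {V : Type u₁} {E : Type u₂}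
    {X : OrGraph V E} {Y Z : X.Subgraph} (hY : Y.IsComponentOf Z) {f : E} (hfZ : f ∈ Z.edges)
    (hfY : f ∉ Y.edges) : X.src f ∉ Y.verts ∧ X.tgt f ∉ Y.verts := by
  obtain ⟨v, -, hverts, hedges⟩ := hY
  have hsrc : X.src f ∉ Y.verts := fun h => hfY (hedges ▸ ⟨hfZ, h⟩)
  refine ⟨hsrc, fun h => hsrc ?_⟩
  rw [hverts] at h ⊢
  exact ⟨Z.src_mem f hfZ, .trans _ _ _ h.2 (.symm _ _ (.rel _ _ ⟨f, hfZ, rfl, rfl⟩))⟩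

namespace GraphOfGroups

variable {V : Type u₁} {E : Type u₂} {X : OrGraph V E}

section UniversalProperty

variable (G : GraphOfGroups.{u₁, u₂, u₃, u₄} X) {H : Type*} [Group H]

/-- The universal property of `F(𝒢, X)`. -/
def pathGroupLift (fv : ∀ v, G.vGrp v →* H) (fe : E → H)
    (h : ∀ f g, fe f * fv _ (G.toTgt f g) * (fe f)⁻¹ = fv _ (G.toSrc f g)) :
    G.PathGroup →* H :=
  QuotientGroup.lift (Subgroup.normalClosure G.relators)
    (Monoid.Coprod.lift (Monoid.CoprodI.lift fv) (FreeGroup.lift fe)) (by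
      refine Subgroup.normalClosure_le_normal (N := MonoidHom.ker _) ?_
      rintro _ ⟨f, g, rfl⟩
      simpa [mul_inv_eq_one] using h f g)

variable {fv : ∀ v, G.vGrp v →* H} {fe : E → H}
  (h : ∀ f g, fe f * fv _ (G.toTgt f g) * (fe f)⁻¹ = fv _ (G.toSrc f g))

theorem pathGroupLift_ofVert (v : V) (g : G.vGrp v) :
    G.pathGroupLift fv fe h (G.ofVert v g) = fv v g :=
  (Monoid.Coprod.lift_apply_inl _ (FreeGroup.lift fe) _).trans (Monoid.CoprodI.lift_of fv g)

theorem pathGroupLift_ofEdge (f : E) : G.pathGroupLift fv fe h (G.ofEdge f) = fe f :=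
  (Monoid.Coprod.lift_apply_inr (Monoid.CoprodI.lift fv) _ _).trans FreeGroup.lift_apply_of

variable {G}

theorem pathGroup_hom_ext {φ ψ : G.PathGroup →* H}
    (hv : ∀ v g, φ (G.ofVert v g) = ψ (G.ofVert v g))
    (he : ∀ f, φ (G.ofEdge f) = ψ (G.ofEdge f)) : φ = ψ :=
  QuotientGroup.monoidHom_ext _ (Monoid.Coprod.hom_ext
    (Monoid.CoprodI.ext_hom _ _ fun v => MonoidHom.ext (hv v)) (FreeGroup.ext_hom _ _ he))

end UniversalProperty

variable {G : GraphOfGroups.{u₁, u₂, u₃, u₄} X}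

section Homomorphisms

variable (G) in
theorem exists_isPath (hX : X.Connected) (v w : V) : ∃ x, G.IsPath v w x := by
  induction hX.2 v w with
  | rel a b h =>
    obtain ⟨f, -, rfl, rfl⟩ := h
    exact ⟨_, .edge f⟩
  | refl a => exact ⟨_, .vert a 1⟩
  | symm a b _ ih =>
    obtain ⟨x, hx⟩ := ih
    exact ⟨_, hx.inv⟩
  | trans a b c _ _ ih₁ ih₂ =>
    obtain ⟨x, hx⟩ := ih₁
    obtain ⟨y, hy⟩ := ih₂
    exact ⟨_, hx.mul hy⟩

/-- The homomorphism from `F(𝒢, X)` to `π₁(𝒢, X, x₀)` that closes up each path by the chosen paths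
`p v` from `x₀` to the vertices `v`. -/
def toPiOne {x₀ : V} {p : V → G.PathGroup} (hp : ∀ v, G.IsPath x₀ v (p v)) :
    G.PathGroup →* G.piOne x₀ :=
  G.pathGroupLift
    (fun v =>
      { toFun g := ⟨p v * G.ofVert v g * (p v)⁻¹, ((hp v).mul (.vert v g)).mul (hp v).inv⟩
        map_one' := by ext; simp
        map_mul' g h := by ext; simp })
    (fun f => ⟨p (X.src f) * G.ofEdge f * (p (X.tgt f))⁻¹, ((hp _).mul (.edge f)).mul (hp _).inv⟩)
    (fun f g => by
      ext
      simp only [Subgroup.coe_mul, Subgroup.coe_inv, MonoidHom.coe_mk, OneHom.coe_mk,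
        ← G.ofEdge_mul_toTgt f g]
      group)

theorem IsPath.coe_toPiOne {x₀ : V} {p : V → G.PathGroup} (hp : ∀ v, G.IsPath x₀ v (p v))
    {v w : V} {x : G.PathGroup} (hx : G.IsPath v w x) :
    (toPiOne hp x : G.PathGroup) = p v * x * (p w)⁻¹ := by
  induction hx with
  | vert v g => simp only [toPiOne, pathGroupLift_ofVert]; rfl
  | edge f => simp only [toPiOne, pathGroupLift_ofEdge]
  | edgeInv f =>
    simp only [toPiOne, map_inv, pathGroupLift_ofEdge, Subgroup.coe_inv]
    group
  | mul _ _ h₁ h₂ =>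
    rw [map_mul, Subgroup.coe_mul, h₁, h₂]
    group

variable (G)

theorem exists_hom_piOne (hX : X.Connected) (x₀ : V) :
    ∃ ρ : G.PathGroup →* G.piOne x₀, ∀ v u, G.IsPath v v u → ρ u = 1 → u = 1 := by
  choose p hp using G.exists_isPath hX x₀
  refine ⟨toPiOne hp, fun v u hu h => ?_⟩
  have hconj := hu.coe_toPiOne hp
  rw [h, Subgroup.coe_one] at hconj
  exact conj_eq_one_iff.1 hconj.symm

theorem pathGroupMap_injective {Y : X.Subgraph} (hY : ∀ f ∉ Y.edges,
    Subsingleton (G.eGrp f) ∨ X.src f ∉ Y.verts ∧ X.tgt f ∉ Y.verts) :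
    Function.Injective (G.pathGroupMap Y) := by
  classical
  let fv : ∀ v, G.vGrp v →* (G.restrict Y).PathGroup := fun v =>
    if h : v ∈ Y.verts then (G.restrict Y).ofVert ⟨v, h⟩ else 1
  let fe : E → (G.restrict Y).PathGroup := fun f =>
    if h : f ∈ Y.edges then (G.restrict Y).ofEdge ⟨f, h⟩ else 1
  have hrel : ∀ f g, fe f * fv _ (G.toTgt f g) * (fe f)⁻¹ = fv _ (G.toSrc f g) := by
    intro f g
    by_cases hf : f ∈ Y.edges
    · simp only [fe, fv, dif_pos hf, dif_pos (Y.src_mem f hf), dif_pos (Y.tgt_mem f hf)]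
      exact (G.restrict Y).ofEdge_mul_toTgt ⟨f, hf⟩ g
    · obtain hsub | ⟨hsrc, htgt⟩ := hY f hf
      · simp [Subsingleton.elim g 1]
      · simp [fv, hsrc, htgt]
  have hleft : (G.pathGroupLift fv fe hrel).comp (G.pathGroupMap Y) = MonoidHom.id _ := by
    refine pathGroup_hom_ext (fun v g => ?_) (fun f => ?_)
    · rw [MonoidHom.comp_apply, pathGroupMap_ofVert, pathGroupLift_ofVert]
      simp only [fv, dif_pos v.2]
      rfl
    · rw [MonoidHom.comp_apply, pathGroupMap_ofEdge, pathGroupLift_ofEdge]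
      simp only [fe, dif_pos f.2]
      rfl
  exact Function.LeftInverse.injective (g := G.pathGroupLift fv fe hrel) (DFunLike.congr_fun hleft)

theorem exists_hom_update {H : Type*} [Group H] {e : E} (he : Subsingleton (G.eGrp e))
    (Ψ : G.PathGroup →* H) (τ : H) :
    ∃ Φ : G.PathGroup →* H, Φ (G.ofEdge e) = τ ∧ ∀ Y : X.Subgraph, e ∉ Y.edges →
      ∀ x, Φ (G.pathGroupMap Y x) = Ψ (G.pathGroupMap Y x) := by
  classical
  let fe : E → H := Function.update (fun f => Ψ (G.ofEdge f)) e τ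
  have hrel : ∀ f g, fe f * Ψ (G.ofVert _ (G.toTgt f g)) * (fe f)⁻¹ =
      Ψ (G.ofVert _ (G.toSrc f g)) := by
    intro f g
    by_cases hf : f = e
    · subst hf
      simp [Subsingleton.elim g 1]
    · simp only [fe, Function.update_of_ne hf, ← G.ofEdge_mul_toTgt f g, map_mul, map_inv]
  let Φ := G.pathGroupLift (fun v => Ψ.comp (G.ofVert v)) fe hrel
  refine ⟨Φ, by rw [pathGroupLift_ofEdge]; exact Function.update_self .., fun Y hY => ?_⟩
  have hcomp : Φ.comp (G.pathGroupMap Y) = Ψ.comp (G.pathGroupMap Y) := by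
    refine pathGroup_hom_ext (fun v g => ?_) (fun f => ?_)
    · rw [MonoidHom.comp_apply, MonoidHom.comp_apply, pathGroupMap_ofVert]
      exact G.pathGroupLift_ofVert hrel v.1 g
    · simp only [Φ, fe, MonoidHom.comp_apply, pathGroupMap_ofEdge, pathGroupLift_ofEdge,
        Function.update_of_ne fun h : f.1 = e => hY (h ▸ f.2)]
  exact DFunLike.congr_fun hcomp

end Homomorphisms

section Line

variable (G)

/-- The element of `F(𝒢, X)` given by an oriented edge. -/
def ofDir (d : E × Bool) : G.PathGroup := bif d.2 then G.ofEdge d.1 else (G.ofEdge d.1)⁻¹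

theorem isPath_ofDir (d : E × Bool) : G.IsPath (X.ini d) (X.ter d) (G.ofDir d) := by
  obtain ⟨f, _ | _⟩ := d
  · exact .edgeInv f
  · exact .edge f

theorem ofDir_mem_range {Y : X.Subgraph} {d : E × Bool}
    (hd : d.1 ∈ Y.edges) : G.ofDir d ∈ (G.pathGroupMap Y).range := by
  have hmem : G.ofEdge d.1 ∈ (G.pathGroupMap Y).range := ⟨_, G.pathGroupMap_ofEdge Y ⟨_, hd⟩⟩
  obtain ⟨f, _ | _⟩ := d
  · exact inv_mem hmem
  · exact hmem

/-- A bi-infinite edge path without backtracking in the Bass–Serre tree, described in `F(𝒢, X)`: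
the `n`-th edge lies over the oriented edge `d n` of `X`, it starts at the vertex represented by
the path `q n` and ends at the one represented by `q n * G.ofDir (d n)`. -/
structure IsLine (d : ℤ → E × Bool) (q : ℤ → G.PathGroup) : Prop where
  ter_eq : ∀ n, X.ter (d n) = X.ini (d (n + 1))
  step : ∀ n, ∃ g, q (n + 1) = q n * G.ofDir (d n) * G.ofVert (X.ter (d n)) g
  distinct : ∀ n j, X.ter (d n) = X.ini (d j) → q n * G.ofDir (d n) = q j → n + 1 = j

variable {G} {d : ℤ → E × Bool} {q : ℤ → G.PathGroup}

/-- The part of a line that lies strictly between its `n`-th and its `j`-th edge. -/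
def link (d : ℤ → E × Bool) (q : ℤ → G.PathGroup) (n j : ℤ) : G.PathGroup :=
  (q n * G.ofDir (d n))⁻¹ * q j

theorem link_add_one (d : ℤ → E × Bool) (q : ℤ → G.PathGroup) (n j : ℤ) :
    link d q n (j + 1) = link d q n j * G.ofDir (d j) * link d q j (j + 1) := by
  simp only [link]
  group

namespace IsLine

theorem exists_link_eq_ofVert (h : G.IsLine d q) (n : ℤ) :
    ∃ g, link d q n (n + 1) = G.ofVert (X.ter (d n)) g := by
  obtain ⟨g, hg⟩ := h.step n
  exact ⟨g, by rw [link, hg, inv_mul_cancel_left]⟩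

theorem isPath_link (h : G.IsLine d q) {n j : ℤ} (hnj : n < j) :
    G.IsPath (X.ter (d n)) (X.ini (d j)) (link d q n j) := by
  have hnext (m : ℤ) : G.IsPath (X.ter (d m)) (X.ini (d (m + 1))) (link d q m (m + 1)) := by
    obtain ⟨g, hg⟩ := h.exists_link_eq_ofVert m
    rw [hg, ← h.ter_eq]
    exact .vert _ g
  induction j, Int.add_one_le_of_lt hnj using Int.leInduction with
  | base => exact hnext n
  | succ j hj ih =>
    rw [link_add_one]
    exact ((ih (by omega)).mul (G.isPath_ofDir (d j))).mul (hnext j)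

theorem link_mem_range (h : G.IsLine d q) {Y : X.Subgraph} {n j : ℤ} (hnj : n < j)
    (hn : X.ter (d n) ∈ Y.verts) (hY : ∀ m, n < m → m < j → (d m).1 ∈ Y.edges) :
    link d q n j ∈ (G.pathGroupMap Y).range := by
  have hvert (m : ℤ) (hm : X.ter (d m) ∈ Y.verts) :
      link d q m (m + 1) ∈ (G.pathGroupMap Y).range := by
    obtain ⟨g, hg⟩ := h.exists_link_eq_ofVert m
    exact hg ▸ ⟨_, G.pathGroupMap_ofVert Y ⟨_, hm⟩ g⟩
  induction j, Int.add_one_le_of_lt hnj using Int.leInduction with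
  | base => exact hvert n hn
  | succ j hj ih =>
    have hdj : (d j).1 ∈ Y.edges := hY j (by omega) (by omega)
    rw [link_add_one]
    exact mul_mem (mul_mem (ih (by omega) fun m hm hmj => hY m hm (by omega))
      (G.ofDir_mem_range hdj)) (hvert j (Y.ter_mem hdj))

theorem link_ne_one (h : G.IsLine d q) {n j : ℤ} (hnj : n < j) (he : (d n).1 = (d j).1)
    (hne : (d n).2 ≠ (d j).2) : link d q n j ≠ 1 := by
  intro hlink
  have hj : d n = ((d j).1, !(d j).2) := Prod.ext he (Bool.eq_not.2 hne)
  have hback : q j * G.ofDir (d j) = q n := by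
    rw [← inv_mul_eq_one.1 hlink, hj]
    cases hb : (d j).2 <;> simp [ofDir, hb]
  have hturn : X.ter (d j) = X.ini (d n) := by
    rw [hj]
    cases hb : (d j).2 <;> simp [OrGraph.ter, OrGraph.ini, hb]
  have := h.distinct j n hturn hback
  omega

theorem isSyllableProduct (h : G.IsLine d q) {e : E} {i j : ℤ} (hij : i < j)
    (hi : (d i).1 = e) (hj : (d j).1 = e) :
    IsSyllableProduct (G.ofEdge e) (G.pathGroupMap (X.deleteEdge e)).range
      {u | (∃ v, G.IsPath v v u) ∧ u ≠ 1} (d i).2 (d j).2 ((q i)⁻¹ * q j) := by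
  by_cases hmid : ∃ m, i < m ∧ m < j ∧ (d m).1 = e
  · obtain ⟨m, him, hmj, hm⟩ := hmid
    have hprod : (q i)⁻¹ * q j = (q i)⁻¹ * q m * ((q m)⁻¹ * q j) := by group
    rw [hprod]
    exact .mul (h.isSyllableProduct him hi hm) (h.isSyllableProduct hmj hm hj)
  · push Not at hmid
    have hsyll : (q i)⁻¹ * q j =
        (bif (d i).2 then G.ofEdge e else (G.ofEdge e)⁻¹) * link d q i j := by
      rw [link, ← hi, ← ofDir]
      group
    rw [hsyll]
    refine .syllable (h.link_mem_range hij trivial hmid) fun hne =>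
      ⟨⟨X.ter (d i), ?_⟩, h.link_ne_one hij (hi.trans hj.symm) hne⟩
    have hturn : X.ini (d j) = X.ter (d i) := by
      rw [← Prod.mk.eta (p := d i), hi, ← Prod.mk.eta (p := d j), hj, Bool.eq_not.2 hne]
      cases (d j).2 <;> rfl
    exact hturn ▸ h.isPath_link hij
termination_by (j - i).toNat

end IsLine

end Line

section Axis

variable {x₀ : V}

/-- The oriented edge of `X` below an oriented edge of the Bass–Serre tree. -/
def dirBelow (δ : G.TreeEdge x₀ × Bool) : E × Bool := (δ.1.1, δ.2)

/-- The vertex of the Bass–Serre tree given by a path. -/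
def treeVert {v : V} {q : G.PathGroup} (h : G.IsPath x₀ v q) : G.TreeVert x₀ :=
  ⟨v, QuotientGroup.mk q, q, h, rfl⟩

theorem treeVert_congr {v w : V} {q r : G.PathGroup} (hq : G.IsPath x₀ v q)
    (hr : G.IsPath x₀ w r) (hvw : v = w) (hqr : q = r) : treeVert hq = treeVert hr := by
  subst hvw hqr
  rfl

theorem eq_and_exists_eq_mul_of_treeVert_eq {v w : V} {q r : G.PathGroup} {hq : G.IsPath x₀ v q}
    {hr : G.IsPath x₀ w r} (h : treeVert hq = treeVert hr) :
    v = w ∧ ∃ g : G.vGrp v, r = q * G.ofVert v g := by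
  obtain rfl : v = w := congrArg Sigma.fst h
  refine ⟨rfl, ?_⟩
  have hcoset : (QuotientGroup.mk q : G.PathGroup ⧸ G.vertSubgroup v) = QuotientGroup.mk r :=
    congrArg Subtype.val (eq_of_heq (Sigma.mk.inj h).2)
  obtain ⟨g, hg⟩ := QuotientGroup.eq.1 hcoset
  exact ⟨g, by rw [hg, mul_inv_cancel_left]⟩

/-- `q` represents the origin of the oriented edge `δ` of the Bass–Serre tree, in such a way that
`q * G.ofDir (dirBelow δ)` represents its end. -/
def IsEdgeRep (δ : G.TreeEdge x₀ × Bool) (q : G.PathGroup) : Prop :=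
  ∃ p, G.IsPath x₀ (X.src δ.1.1) p ∧ QuotientGroup.mk p = δ.1.2.1 ∧
    q = bif δ.2 then p else p * G.ofEdge δ.1.1

theorem exists_isEdgeRep (δ : G.TreeEdge x₀ × Bool) : ∃ q, IsEdgeRep δ q := by
  obtain ⟨p, hp, hδ⟩ := δ.1.2.2
  exact ⟨_, p, hp, hδ, rfl⟩

namespace IsEdgeRep

variable {δ : G.TreeEdge x₀ × Bool} {q r : G.PathGroup}

theorem isPath (h : IsEdgeRep δ q) : G.IsPath x₀ (X.ini (dirBelow δ)) q := by
  obtain ⟨ε, _ | _⟩ := δ <;> obtain ⟨p, hp, -, rfl⟩ := h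
  · exact hp.mul (.edge _)
  · exact hp

theorem ini_eq (h : IsEdgeRep δ q) : (G.tree x₀).ini δ = treeVert h.isPath := by
  obtain ⟨⟨f, c, hc⟩, _ | _⟩ := δ <;>
    obtain ⟨p, -, (rfl : QuotientGroup.mk p = c), rfl⟩ := id h <;> rfl

theorem ter_eq (h : IsEdgeRep δ q) :
    (G.tree x₀).ter δ = treeVert (h.isPath.mul (G.isPath_ofDir _)) := by
  obtain ⟨⟨f, c, hc⟩, _ | _⟩ := δ <;>
    obtain ⟨p, hp, (rfl : QuotientGroup.mk p = c), rfl⟩ := id h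
  · exact treeVert_congr (v := X.src f) hp (h.isPath.mul (G.isPath_ofDir _)) rfl
      (mul_inv_cancel_right p (G.ofEdge f)).symm
  · rfl

theorem smul (h : IsEdgeRep δ q) (R : G.piOne x₀) : IsEdgeRep (R • δ.1, δ.2) (R * q) := by
  obtain ⟨p, hp, hδ, rfl⟩ := h
  refine ⟨R * p, IsPath.mul R.2 hp, congrArg (R.1 • ·) hδ, ?_⟩
  obtain ⟨ε, _ | _⟩ := δ
  · exact (mul_assoc _ _ _).symm
  · rfl

theorem eq (hq : IsEdgeRep δ q) (hr : IsEdgeRep δ r) (h : Subsingleton (G.eGrp δ.1.1)) :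
    q = r := by
  obtain ⟨p, -, hp, rfl⟩ := hq
  obtain ⟨p', -, hp', rfl⟩ := hr
  obtain ⟨g, hg⟩ := QuotientGroup.eq.1 (hp.trans hp'.symm)
  rw [Subsingleton.elim g 1, map_one, eq_comm, inv_mul_eq_one] at hg
  rw [hg]

end IsEdgeRep

theorem IsAxis.exists_isLine {R : G.piOne x₀} {α : ℤ → G.TreeEdge x₀ × Bool} {k : ℕ}
    (h : G.IsAxis x₀ R α k) : ∃ q : ℤ → G.PathGroup, G.IsLine (fun n => dirBelow (α n)) q ∧
      ∀ n, Subsingleton (G.eGrp (α n).1.1) → q (n + k) = R * q n := by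
  choose q hq using fun n => exists_isEdgeRep (α n)
  have hchain (n : ℤ) : treeVert ((hq n).isPath.mul (G.isPath_ofDir _)) =
      treeVert (hq (n + 1)).isPath := by
    rw [← (hq n).ter_eq, ← (hq (n + 1)).ini_eq, h.chain]
  refine ⟨q, ⟨fun n => (eq_and_exists_eq_mul_of_treeVert_eq (hchain n)).1,
    fun n => (eq_and_exists_eq_mul_of_treeVert_eq (hchain n)).2, fun n j hvert hpath => ?_⟩,
    fun n hn => ?_⟩
  · refine h.distinct (?_ : (G.tree x₀).ini _ = (G.tree x₀).ini _)
    rw [← h.chain, (hq n).ter_eq, (hq j).ini_eq]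
    exact treeVert_congr _ _ hvert hpath
  · have hshift := h.shift n
    exact (hq (n + k)).eq (hshift ▸ (hq n).smul R) (hshift ▸ hn)

theorem exists_isAxis_of_eLength_pos {e : E} {R : G.piOne x₀} (hR : 0 < G.eLength x₀ e R) :
    ∃ (α : ℤ → G.TreeEdge x₀ × Bool) (k : ℕ) (i : ℤ), G.IsAxis x₀ R α k ∧ (α i).1.1 = e := by
  classical
  rw [eLength] at hR
  split_ifs at hR with h
  · obtain ⟨i, hi⟩ := Finset.card_pos.1 hR
    exact ⟨_, _, i, h.choose_spec, (Finset.mem_filter.1 hi).2⟩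
  · exact absurd hR (lt_irrefl 0)

theorem exists_isSyllableProduct_conj {e : E} (he : Subsingleton (G.eGrp e)) {R : G.piOne x₀}
    (hR : 0 < G.eLength x₀ e R) : ∃ (g : G.PathGroup) (ε : Bool),
      IsSyllableProduct (G.ofEdge e) (G.pathGroupMap (X.deleteEdge e)).range
        {u | (∃ v, G.IsPath v v u) ∧ u ≠ 1} ε ε (g⁻¹ * R * g) := by
  obtain ⟨α, k, i, hα, hi⟩ := exists_isAxis_of_eLength_pos hR
  obtain ⟨q, hq, hshift⟩ := hα.exists_isLine
  have hik : i < i + k := by have := hα.pos; omega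
  have hsyll := hq.isSyllableProduct hik hi (by rw [dirBelow, hα.shift]; exact hi)
  rw [hshift i (hi ▸ he), ← mul_assoc] at hsyll
  have hsign : (dirBelow (α (i + k))).2 = (dirBelow (α i)).2 := by rw [dirBelow, hα.shift]; rfl
  exact ⟨q i, _, hsign ▸ hsyll⟩

end Axis

end GraphOfGroups

/-- Fully residually free groups: the limit groups without the assumption of finite generation. -/
def IsFullyResiduallyFree (Γ : Type u) [Group Γ] : Prop :=
  ∀ S : Finset Γ, ∃ (ι : Type w) (φ : Γ →* FreeGroup ι), Set.InjOn φ (S : Set Γ)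

theorem IsFullyResiduallyFree.exists_hom_eq_one {Γ : Type u} [Group Γ]
    (hΓ : IsFullyResiduallyFree.{u, w} Γ) (S : Finset Γ) :
    ∃ (ι : Type w) (φ : Γ →* FreeGroup ι), ∀ x ∈ S, φ x = 1 → x = 1 := by
  classical
  obtain ⟨ι, φ, hφ⟩ := hΓ (insert 1 S)
  exact ⟨ι, φ, fun x hx h => hφ (by simp [hx]) (by simp) (h.trans (map_one φ).symm)⟩

namespace GraphOfGroups

variable {V : Type u₁} {E : Type u₂} {X : OrGraph V E} {G : GraphOfGroups.{u₁, u₂, u₃, u₄} X}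
  {e : E}

theorem exists_hom_isSyllableProduct (hX : X.Connected) {x₀ : V}
    (hΓ : IsFullyResiduallyFree.{_, w} (G.piOne x₀)) (he : Subsingleton (G.eGrp e))
    {x : G.PathGroup} {ε δ : Bool}
    (hx : IsSyllableProduct (G.ofEdge e) (G.pathGroupMap (X.deleteEdge e)).range
      {u | (∃ v, G.IsPath v v u) ∧ u ≠ 1} ε δ x)
    {v : V} {b : G.PathGroup} (hb : G.IsPath v v b) :
    ∃ (ι : Type w) (Φ : G.PathGroup →* FreeGroup (Option ι)) (a : FreeGroup ι),
      IsSyllableProduct (FreeGroup.of none) (FreeGroup.map some).range {1}ᶜ ε δ (Φ x) ∧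
      (a = 1 → b = 1) ∧
      ∀ Y : X.Subgraph, e ∉ Y.edges → b ∈ (G.pathGroupMap Y).range →
        Φ b = FreeGroup.map some a := by
  classical
  obtain ⟨S, hS, hxS⟩ := hx.exists_finset
  obtain ⟨ρ, hρ⟩ := G.exists_hom_piOne hX x₀
  obtain ⟨ι, ψ, hψ⟩ := hΓ.exists_hom_eq_one (insert (ρ b) (S.image ρ))
  obtain ⟨Φ, hΦe, hΦ⟩ := G.exists_hom_update he ((FreeGroup.map some).comp (ψ.comp ρ))
    (FreeGroup.of none)
  have hΦdelete (y) : Φ (G.pathGroupMap (X.deleteEdge e) y) =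
      FreeGroup.map some (ψ (ρ (G.pathGroupMap (X.deleteEdge e) y))) :=
    hΦ (X.deleteEdge e) (fun h => h rfl) y
  refine ⟨ι, Φ, ψ (ρ b), hΦe ▸ hxS Φ ?_ fun u hu hΦu => ?_,
    fun h => hρ v b hb (hψ _ (Finset.mem_insert_self _ _) h), ?_⟩
  · rintro _ ⟨y, rfl⟩
    exact ⟨_, (hΦdelete y).symm⟩
  · obtain ⟨⟨y, rfl⟩, ⟨v', hpath⟩, hne⟩ := hS u hu
    rw [Set.mem_singleton_iff, hΦdelete,
      map_eq_one_iff _ (FreeGroup.map_injective (Option.some_injective ι))] at hΦu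
    exact hne (hρ v' _ hpath (hψ _ (Finset.mem_insert_of_mem (Finset.mem_image_of_mem ρ hu)) hΦu))
  · rintro Y heY ⟨y, rfl⟩
    exact hΦ Y heY y

theorem eq_one_of_mem_normalClosure (hX : X.Connected) {x₀ : V}
    (hΓ : IsFullyResiduallyFree.{_, w} (G.piOne x₀)) (he : Subsingleton (G.eGrp e))
    {R : G.piOne x₀} (hR : 0 < G.eLength x₀ e R) {Y : X.Subgraph} (heY : e ∉ Y.edges) {v : V}
    {b : G.PathGroup} (hb : G.IsPath v v b) (hbY : b ∈ (G.pathGroupMap Y).range)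
    (hbR : b ∈ Subgroup.normalClosure {(R : G.PathGroup)}) : b = 1 := by
  obtain ⟨g, ε, hsyll⟩ := exists_isSyllableProduct_conj he hR
  obtain ⟨ι, Φ, a, hΦsyll, ha, hΦb⟩ := exists_hom_isSyllableProduct hX hΓ he hsyll hb
  have hconj := Freiheitssatz.normalClosure_singleton_conj g⁻¹ (R : G.PathGroup)
  rw [inv_inv] at hconj
  rw [← hconj] at hbR
  have hΦbR := Freiheitssatz.map_mem_normalClosure_singleton Φ hbR
  rw [hΦb Y heY hbY] at hΦbR
  exact ha (hΦsyll.eq_one_of_map_some_mem_normalClosure hΦbR)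

end GraphOfGroups

theorem proposition2p1_general {V : Type u₁} {E : Type u₂} (X : OrGraph V E) (hX : X.Connected)
    (G : GraphOfGroups.{u₁, u₂, u₃, u₄} X) (x₀ : V)
    (hΓ : IsFullyResiduallyFree.{max u₁ u₂ u₃, w} (G.piOne x₀))
    (e : E) (he : Subsingleton (G.eGrp e)) (Y : X.Subgraph) (heY : e ∉ Y.edges)
    (hY : ∀ f ∉ Y.edges, Subsingleton (G.eGrp f) ∨ X.src f ∉ Y.verts ∧ X.tgt f ∉ Y.verts)
    (y₀ : Y.verts) (c : G.PathGroup) (hc : G.IsPath x₀ y₀.1 c)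
    (R : G.piOne x₀) (hR : 0 < G.eLength x₀ e R) :
    Function.Injective
      ((QuotientGroup.mk' (Subgroup.normalClosure {R})).comp (G.piOneMap Y y₀ x₀ c hc)) := by
  rw [injective_iff_map_eq_one]
  intro a ha
  have hconj : c * G.pathGroupMap Y a * c⁻¹ ∈ Subgroup.normalClosure {(R : G.PathGroup)} :=
    Freiheitssatz.map_mem_normalClosure_singleton (G.piOne x₀).subtype
      ((QuotientGroup.eq_one_iff _).1 ha)
  have hmem : G.pathGroupMap Y a ∈ Subgroup.normalClosure {(R : G.PathGroup)} := by
    simpa [mul_assoc] using Subgroup.normalClosure_normal.conj_mem _ hconj c⁻¹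
  have hone := GraphOfGroups.eq_one_of_mem_normalClosure hX hΓ he hR heY
    (GraphOfGroups.IsPath.map a.2) ⟨_, rfl⟩ hmem
  exact Subtype.ext (G.pathGroupMap_injective hY (hone.trans (map_one _).symm))

theorem proposition2p1 {V : Type u₁} {E : Type u₂} (X : OrGraph V E) (hX : X.Connected)
    (G : GraphOfGroups.{u₁, u₂, u₃, u₄} X) (x₀ : V) (hΓ : IsLimitGroup (G.piOne x₀))
    (e : E) (he : Subsingleton (G.eGrp e))
    (Y : X.Subgraph) (hY : Y.IsComponentOf (X.deleteEdge e))
    (y₀ : Y.verts) (c : G.PathGroup) (hc : G.IsPath x₀ y₀.1 c)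
    (R : G.piOne x₀) (hR : 0 < G.eLength x₀ e R) :
    Function.Injective
      ((QuotientGroup.mk' (Subgroup.normalClosure {R})).comp (G.piOneMap Y y₀ x₀ c hc)) :=
  proposition2p1_general X hX G x₀ hΓ.2 e he Y (fun h => hY.edges_subset h rfl)
    (fun f hf => (eq_or_ne f e).imp (fun (h : f = e) => h ▸ he) fun h => hY.src_tgt_notMem h hf)
    y₀ c hc R hR
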